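/- All graphs are finite and simple. For an edge-coloured graph (adjacent edges may receive the same colour), a path is called \emph{proper} if no two adjacent edges of the path have the same colour. For a connected graph $G$, the \emph{proper connection number} $pc(G)$ is the minimum number of colours in an edge-colouring of $G$ such that every two distinct vertices of $G$ are connected by a proper path. For $a,b\ge 1$, let $T(a,b)$ denote the double star whose two adjacent centres have degrees $a$ and $b$, that is, the tree on $a+b$ vertices obtained from an edge $uv$ by attaching $a-1$ leaves to $u$ and $b-1$ leaves to $v$. \textbf{Theorem.} Let $G$ be a graph on $n\ge 5$ vertices such that both $G$ and its complement $\overline{G}$ are connected. Then $$4\le pc(G)+pc(\overline{G})\le n,$$ and $pc(G)+pc(\overline{G})=n$ if and only if $G\cong T(2,n-2)$ or $\overline{G}\cong T(2,n-2)$. -/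

import Mathlib

namespace SimpleGraph

universe u v

variable {V : Type u} {K : Type v}

/-- A walk of the edge-coloured graph `G` is a proper path if it is a path and any two
consecutive edges of it (in a path these are the pairs of adjacent edges) have different colours. -/
def Walk.IsProperPath {G : SimpleGraph V} (c : G.EdgeLabeling K) {x y : V} (p : G.Walk x y) :
    Prop :=
  p.IsPath ∧ (p.darts.map fun d => c.get d.fst d.snd d.adj).IsChain (· ≠ ·)

/-- Every two distinct vertices are joined by a proper path. Adjacent edges may have the same
colour. -/
def EdgeLabeling.IsProperPathColoring {G : SimpleGraph V} (c : G.EdgeLabeling K) : Prop :=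
  ∀ x y : V, x ≠ y → ∃ p : G.Walk x y, p.IsProperPath c

/-- The proper connection number `pc(G)`: the least number of colours of a proper-path colouring
of `G`. For a finite connected graph such a colouring exists
(`exists_isProperPathColoring`), so the minimum is attained. -/
noncomputable def properConnectionNumber (G : SimpleGraph V) : ℕ :=
  sInf {k : ℕ | ∃ c : G.EdgeLabeling (Fin k), c.IsProperPathColoring}

theorem exists_isProperPathColoring [Finite V] {G : SimpleGraph V} (hG : G.Connected) :
    ∃ k : ℕ, ∃ c : G.EdgeLabeling (Fin k), c.IsProperPathColoring := by
  classical
  obtain ⟨k, ⟨e⟩⟩ := Finite.exists_equiv_fin G.edgeSet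
  refine ⟨k, fun a => e a, fun x y _ => ?_⟩
  obtain ⟨p, hp⟩ := hG.exists_isPath x y
  refine ⟨p, hp, ?_⟩
  rw [List.isChain_map]
  have h : p.darts.Pairwise fun d d' => d.edge ≠ d'.edge :=
    List.pairwise_map.mp hp.isTrail.edges_nodup
  refine h.isChain.imp fun d d' hne heq => hne ?_
  exact congrArg Subtype.val (e.injective heq)

/-- The double star `T(a, b)` (for `a, b ≥ 1`): two adjacent centres `inl none` and `inr none`,
of degrees `a` and `b`, so that `a - 1` leaves hang on the first and `b - 1` on the second. -/
def doubleStar (a b : ℕ) : SimpleGraph (Option (Fin (a - 1)) ⊕ Option (Fin (b - 1))) :=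
  SimpleGraph.fromRel fun x y =>
    (x = Sum.inl none ∧ y = Sum.inr none) ∨
    (x = Sum.inl none ∧ ∃ i, y = Sum.inl (some i)) ∨
    (x = Sum.inr none ∧ ∃ j, y = Sum.inr (some j))

end SimpleGraph

/-! Neither graph is complete, so both proper connection numbers are at least 2. The core is
`hasAltColoring_or_compl_hasAltColoring`: one of the two numbers is at most 2. By
`exists_isBroom_or_properConnectionNumber_le`, each graph is either T(2, n - 2), with value exactly
n - 2, or has value at most n - 3. Since n - 2 > 2, these facts give the upper bound and the
equality case.

For the core, a cut vertex of `G` leaves a complete bipartite graph in the complement, or else a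
pendant vertex of `G` that becomes a hub of the complement; both carry two-colourings that extend
along pendant edges. Without cut vertices on either side, an edge `xy` whose ends together dominate
the graph is given one colour and all other edges at `x` and `y` the other, so that `xy` is a switch
through which paths are routed. If neither graph has a dominating edge, then nonadjacent vertices
have common neighbours in both graphs. Either `G` always has two of them, or a unique one yields a
complement edge dominating all but one vertex; the switch works in both situations.

For the bound n - 3, a connected graph of maximum degree k contains a connected spanning subgraph
properly edge-coloured with k colours (`exists_connected_proper_edge_coloring`), and any path in it
is proper. -/

namespace SimpleGraph

universe u v

variable {V : Type u}

/-! ### Alternating paths in two-coloured graphs -/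

/-- There is a path from `x` to `y` with vertices in `S` along which the two colours of `f`
alternate, and which is trivial or starts with the colour `i`. -/
def AltReach (G : SimpleGraph V) (f : V → V → Bool) (x : V) (i : Bool) (y : V) (S : Set V) :
    Prop :=
  ∃ p : G.Walk x y, p.IsPath ∧
    ((!i) :: p.darts.map fun d => f d.fst d.snd).IsChain (· ≠ ·) ∧ ∀ z ∈ p.support, z ∈ S

theorem AltReach.nil {G : SimpleGraph V} {f : V → V → Bool} {x : V} {i : Bool} {S : Set V}
    (hx : x ∈ S) : G.AltReach f x i x S :=
  ⟨.nil, by simp, by simp, by simpa using hx⟩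

theorem AltReach.mono {G : SimpleGraph V} {f : V → V → Bool} {x y : V} {i : Bool} {S T : Set V}
    (h : G.AltReach f x i y S) (hST : S ⊆ T) : G.AltReach f x i y T := by
  obtain ⟨p, h1, h2, h3⟩ := h
  exact ⟨p, h1, h2, fun z hz => hST (h3 z hz)⟩

theorem AltReach.congr {G : SimpleGraph V} {f g : V → V → Bool} {x y : V} {i : Bool} {S : Set V}
    (h : G.AltReach f x i y S) (hfg : ∀ u ∈ S, ∀ v ∈ S, f u v = g u v) :
    G.AltReach g x i y S := by
  obtain ⟨p, h1, h2, h3⟩ := h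
  refine ⟨p, h1, ?_, h3⟩
  rwa [List.map_congr_left (g := fun d => f d.fst d.snd)]
  intro d hd
  exact (hfg _ (h3 _ (p.dart_fst_mem_support_of_mem_darts hd)) _
    (h3 _ (p.dart_snd_mem_support_of_mem_darts hd))).symm

/-- The vertex set `S` does the bookkeeping for simplicity: a new first vertex outside `S` cannot
occur on the old path. -/
theorem AltReach.cons {G : SimpleGraph V} {f : V → V → Bool} {x z y : V} {i : Bool} {S : Set V}
    (h : G.Adj x z) (hi : f x z = i) (hx : x ∉ S) (hz : G.AltReach f z (!i) y S) :
    G.AltReach f x i y (insert x S) := by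
  obtain ⟨p, h1, h2, h3⟩ := hz
  refine ⟨.cons h p, ?_, ?_, ?_⟩
  · exact h1.cons fun hx' => hx (h3 _ hx')
  · simp only [Bool.not_not] at h2
    simp [hi, h2]
  · intro w hw
    rw [Walk.support_cons, List.mem_cons] at hw
    rcases hw with rfl | hw
    · exact Set.mem_insert _ _
    · exact Set.mem_insert_of_mem _ (h3 _ hw)

/-- The vertex list `x :: l` is a path of `G` on which the colours of `f` alternate, starting with
the colour `i`. -/
def IsAltList (G : SimpleGraph V) (f : V → V → Bool) : Bool → V → List V → Prop
  | _, _, [] => True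
  | i, x, z :: l => G.Adj x z ∧ f x z = i ∧ x ∉ z :: l ∧ IsAltList G f (!i) z l

/-- Lets an explicit path be given as a vertex list, so that its verification becomes a finite check
of adjacencies, colours and inequalities. -/
theorem IsAltList.altReach {G : SimpleGraph V} {f : V → V → Bool} (l : List V) {i : Bool} {x : V}
    (h : G.IsAltList f i x l) :
    G.AltReach f x i ((x :: l).getLast (by simp)) {z | z ∈ x :: l} := by
  induction l generalizing x i with
  | nil => exact AltReach.nil (by simp)
  | cons z l ih =>
    obtain ⟨h1, h2, h3, h4⟩ := h
    have := AltReach.cons h1 h2 (S := {w | w ∈ z :: l}) h3 (ih h4)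
    rw [List.getLast_cons (by simp)]
    refine this.mono ?_
    intro w hw
    simpa using hw

/-- Some alternating path joins `x` and `y` inside `S`. -/
def AltConn (G : SimpleGraph V) (f : V → V → Bool) (x y : V) (S : Set V) : Prop :=
  ∃ i, G.AltReach f x i y S

theorem AltConn.mono {G : SimpleGraph V} {f : V → V → Bool} {x y : V} {S T : Set V}
    (h : G.AltConn f x y S) (hST : S ⊆ T) : G.AltConn f x y T :=
  let ⟨i, hi⟩ := h
  ⟨i, hi.mono hST⟩

theorem altConn_iff {G : SimpleGraph V} {f : V → V → Bool} {x y : V} {S : Set V} :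
    G.AltConn f x y S ↔ ∃ p : G.Walk x y, p.IsPath ∧
      (p.darts.map fun d => f d.fst d.snd).IsChain (· ≠ ·) ∧ ∀ z ∈ p.support, z ∈ S := by
  constructor
  · rintro ⟨i, p, h1, h2, h3⟩
    exact ⟨p, h1, h2.tail, h3⟩
  · rintro ⟨p, h1, h2, h3⟩
    cases p with
    | nil => exact ⟨true, .nil, h1, by simp, h3⟩
    | @cons _ z _ h p =>
      refine ⟨f x z, .cons h p, h1, ?_, h3⟩
      simp only [Walk.darts_cons, List.map_cons, List.isChain_cons_cons] at h2 ⊢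
      exact ⟨by simp, h2⟩

theorem AltConn.symm {G : SimpleGraph V} {f : V → V → Bool} (hf : ∀ u v, f u v = f v u)
    {x y : V} {S : Set V} (h : G.AltConn f x y S) : G.AltConn f y x S := by
  rw [altConn_iff] at h ⊢
  obtain ⟨p, h1, h2, h3⟩ := h
  refine ⟨p.reverse, h1.reverse, ?_, by simpa using h3⟩
  rw [Walk.darts_reverse, List.map_reverse, List.map_map, List.isChain_reverse]
  have : ((fun d : G.Dart => f d.fst d.snd) ∘ Dart.symm) = fun d => f d.fst d.snd := by
    funext d
    exact hf _ _
  rw [this]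
  exact h2.imp fun a b hab => hab.symm

theorem AltConn.of_adj {G : SimpleGraph V} {f : V → V → Bool} {x y : V} {S : Set V}
    (h : G.Adj x y) (hx : x ∈ S) (hy : y ∈ S) : G.AltConn f x y S :=
  ⟨f x y, (AltReach.cons h rfl (S := {y}) (by simpa using h.ne) (.nil rfl)).mono
    (by simp [Set.insert_subset_iff, hx, hy])⟩

theorem IsAltList.altConn {G : SimpleGraph V} {f : V → V → Bool} (l : List V) {x y : V}
    {S : Set V} (i : Bool) (h : G.IsAltList f i x l) (hy : (x :: l).getLast (by simp) = y)
    (hS : ∀ z ∈ x :: l, z ∈ S) : G.AltConn f x y S :=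
  ⟨i, hy ▸ h.altReach.mono hS⟩

/-- A colouring with two colours for which any two vertices are joined by a proper path. -/
def HasAltColoring (G : SimpleGraph V) : Prop :=
  ∃ f : V → V → Bool, (∀ u v, f u v = f v u) ∧ ∀ x y, x ≠ y → G.AltConn f x y Set.univ

theorem HasAltColoring.properConnectionNumber_le {G : SimpleGraph V} (h : G.HasAltColoring) :
    G.properConnectionNumber ≤ 2 := by
  obtain ⟨f, hf, h⟩ := h
  let e : Bool → Fin 2 := fun b => if b then 1 else 0
  have he : Function.Injective e := by
    intro a b
    cases a <;> cases b <;> simp [e]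
  refine Nat.sInf_le ⟨EdgeLabeling.mk (fun x y _ => e (f x y))
    (fun x y _ => by rw [hf]), fun x y hxy => ?_⟩
  obtain ⟨p, h1, h2, -⟩ := altConn_iff.1 (h x y hxy)
  refine ⟨p, h1, ?_⟩
  rw [List.isChain_map] at h2 ⊢
  refine h2.imp fun a b hab heq => hab (he heq)

/-! ### Rooted two-colourings -/

/-- A two-colouring of the edges inside `S` for which any two vertices of `S` are joined by a proper
path inside `S` and all proper paths to `w` can be chosen to end with the same colour. -/
def RootedAlt (G : SimpleGraph V) (S : Set V) (w : V) : Prop :=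
  ∃ f : V → V → Bool, (∀ u v, f u v = f v u) ∧
    (∀ x ∈ S, ∀ y ∈ S, x ≠ y → G.AltConn f x y S) ∧
    ∃ i, ∀ x ∈ S, x ≠ w → G.AltReach f w i x S

theorem RootedAlt.hasAltColoring {G : SimpleGraph V} {S : Set V} {w : V} (h : G.RootedAlt S w)
    (hS : ∀ x, x ∈ S) : G.HasAltColoring := by
  obtain ⟨f, hf, h, -⟩ := h
  exact ⟨f, hf, fun x y hxy => (h x (hS x) y (hS y) hxy).mono (Set.subset_univ _)⟩

/-- All required paths from the root `w` start with one colour `i`, so an edge `vw` of the other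
colour prolongs each of them, and `v` becomes a root with starting colour `!i`. Paths inside `S`
keep their colours. -/
theorem RootedAlt.adjoin {G : SimpleGraph V} {S : Set V} {w v : V} (h : G.RootedAlt S w)
    (hw : w ∈ S) (hv : v ∉ S) (hvw : G.Adj v w) : G.RootedAlt (insert v S) v := by
  classical
  obtain ⟨f, hf, hS, i, hi⟩ := h
  let g : V → V → Bool := fun a b => if a = v ∨ b = v then !i else f a b
  have hg : ∀ a b, g a b = g b a := by
    intro a b
    simp only [g, hf a b, or_comm]
  have hgf : ∀ a ∈ S, ∀ b ∈ S, f a b = g a b := by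
    intro a ha b hb
    have h1 : a ≠ v := fun h => hv (h ▸ ha)
    have h2 : b ≠ v := fun h => hv (h ▸ hb)
    simp [g, h1, h2]
  have hroot : ∀ x ∈ insert v S, x ≠ v → G.AltReach g v (!i) x (insert v S) := by
    intro x hx hxv
    have hxS : x ∈ S := hx.resolve_left hxv
    refine AltReach.cons hvw (by simp [g]) hv ?_
    rw [Bool.not_not]
    by_cases hxw : x = w
    · subst hxw
      exact .nil hw
    · exact (hi x hxS hxw).congr hgf
  refine ⟨g, hg, ?_, !i, hroot⟩
  intro x hx y hy hxy
  by_cases hxv : x = v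
  · subst hxv
    exact ⟨_, hroot y hy hxy.symm⟩
  by_cases hyv : y = v
  · subst hyv
    exact AltConn.symm hg ⟨_, hroot x hx hxy⟩
  · obtain ⟨j, hj⟩ := hS x (hx.resolve_left hxv) y (hy.resolve_left hyv) hxy
    exact ⟨j, (hj.congr hgf).mono (Set.subset_insert _ _)⟩

/-- Mark one vertex on each side and colour a cross edge by whether exactly one of its ends is
marked. Two vertices of one side are then joined directly through the other side if one of them is
marked, and otherwise by a detour over the edge joining the marked vertices. -/
theorem rootedAlt_of_complete_bipartite {G : SimpleGraph V} {A B : Set V}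
    (hAB : ∀ a ∈ A, ∀ b ∈ B, G.Adj a b) (hA : A.Nontrivial) (hB : B.Nontrivial) {w : V}
    (hw : w ∈ A ∪ B) : G.RootedAlt (A ∪ B) w := by
  classical
  wlog hwB : w ∈ B generalizing A B
  · rw [Set.union_comm]
    exact this (fun b hb a ha => (hAB a ha b hb).symm) hB hA (by rwa [Set.union_comm])
      (hw.resolve_right hwB)
  obtain ⟨a1, ha1, a2, ha2, ha12⟩ := hA
  -- The root stays unmarked, so its edges to unmarked vertices all have the colour `false`, the
  -- common starting colour.
  obtain ⟨b2, hb2, hb2w⟩ := hB.exists_ne w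
  have hd : ∀ a ∈ A, ∀ b ∈ B, a ≠ b := fun a ha b hb => (hAB a ha b hb).ne
  let f : V → V → Bool := fun u v => xor (decide (u = a2 ∨ v = a2)) (decide (u = b2 ∨ v = b2))
  have hf : ∀ u v, f u v = f v u := by
    intro u v
    simp only [f, or_comm]
  have hAA : ∀ a ∈ A, ∀ a' ∈ A, a ≠ a' → a ≠ a2 → G.AltConn f a a' (A ∪ B) := by
    intro a ha a' ha' haa' ha2'
    by_cases h : a' = a2
    · refine IsAltList.altConn [w, a2] false ?_ (by simp [h]) (by simp_all)
      simp [IsAltList, f]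
      grind [Adj.symm]
    · refine IsAltList.altConn [w, a2, b2, a'] false ?_ (by simp) (by simp_all)
      simp [IsAltList, f]
      grind [Adj.symm]
  have hBB : ∀ a ∈ B, ∀ a' ∈ B, a ≠ a' → a ≠ b2 → G.AltConn f a a' (A ∪ B) := by
    intro a ha a' ha' haa' ha2'
    by_cases h : a' = b2
    · refine IsAltList.altConn [a1, b2] false ?_ (by simp [h]) (by simp_all)
      simp [IsAltList, f]
      grind [Adj.symm]
    · refine IsAltList.altConn [a1, b2, a2, a'] false ?_ (by simp) (by simp_all)
      simp [IsAltList, f]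
      grind [Adj.symm]
  refine ⟨f, hf, ?_, false, ?_⟩
  · intro x hx y hy hxy
    rcases hx with hx | hx <;> rcases hy with hy | hy
    · by_cases h : x = a2
      · exact (hAA y hy x hx hxy.symm (by grind)).symm hf
      · exact hAA x hx y hy hxy h
    · exact .of_adj (hAB x hx y hy) (.inl hx) (.inr hy)
    · exact .of_adj (hAB y hy x hx).symm (.inr hx) (.inl hy)
    · by_cases h : x = b2
      · exact (hBB y hy x hx hxy.symm (by grind)).symm hf
      · exact hBB x hx y hy hxy h
  · intro x hx hxw
    rcases hx with hx | hx
    · by_cases h : x = a2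
      · refine (IsAltList.altReach [a1, b2, x] ?_).mono (by grind)
        simp [IsAltList, f]
        grind [Adj.symm]
      · refine (IsAltList.altReach [x] ?_).mono (by grind)
        simp [IsAltList, f]
        grind [Adj.symm]
    · by_cases h : x = b2
      · refine (IsAltList.altReach [a1, x] ?_).mono (by grind)
        simp [IsAltList, f]
        grind [Adj.symm]
      · refine (IsAltList.altReach [a1, b2, a2, x] ?_).mono (by grind)
        simp [IsAltList, f]
        grind [Adj.symm]

/-- Colour an edge at the hub `p` by the parity of the level of its other end, and any other edge by
the parity of its larger level. Vertices of different parity are joined through `p`. For equal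
parity, one of the two first steps down to a neighbour of the preceding level and then goes through
`p`. -/
theorem rootedAlt_of_hub {G : SimpleGraph V} {H E : Set V} {p w : V} (hw : w ∈ H)
    (hH : ∀ h ∈ H, G.Adj p h) (hE : E.Subsingleton) (hpE : ∀ e ∈ E, G.Adj p e)
    (hEH : Disjoint E H) (l : V → ℕ) (hl : ∀ v ∈ H, v ≠ w → ∃ u ∈ H, G.Adj v u ∧ l v = l u + 1)
    (hlw : l w = 0) :
    G.RootedAlt (insert p (H ∪ E)) w := by
  classical
  have hEH' : ∀ e ∈ E, e ∉ H := fun e he heH => Set.disjoint_left.1 hEH he heH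
  -- The extra vertex has no step down, and neither has `w`. Level 1 gives it the parity opposite to
  -- that of `w`, so in a pair of equal parity some vertex can step down.
  let m : V → ℕ := fun v => if v ∈ E then 1 else l v
  have hmE : ∀ e ∈ E, m e = 1 := fun e he => by simp [m, he]
  have hmH : ∀ v ∈ H, m v = l v := fun v hv => by
    have : v ∉ E := fun h => hEH' v h hv
    simp [m, this]
  have hm : ∀ v ∈ H, v ≠ w → ∃ u ∈ H, G.Adj v u ∧ m v = m u + 1 := by
    intro v hv hvw
    obtain ⟨u, hu, h1, h2⟩ := hl v hv hvw
    exact ⟨u, hu, h1, by rw [hmH v hv, hmH u hu, h2]⟩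
  have hmw : m w = 0 := by rw [hmH w hw, hlw]
  have hp : ∀ x ∈ H ∪ E, G.Adj p x := by
    rintro x (hx | hx)
    exacts [hH x hx, hpE x hx]
  have hpn : p ∉ H ∪ E := fun h => (hp p h).ne rfl
  clear_value m
  let f : V → V → Bool := fun u v =>
    if u = p then (m v).bodd else if v = p then (m u).bodd else (max (m u) (m v)).bodd
  have hf : ∀ u v, f u v = f v u := by
    intro u v
    by_cases hu : u = p <;> by_cases hv : v = p <;> simp [f, hu, hv, max_comm]
  have key : ∀ x ∈ H, x ≠ w → ∀ y ∈ H ∪ E, x ≠ y → (m x).bodd = (m y).bodd →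
      G.AltConn f x y (insert p (H ∪ E)) := by
    intro x hx hxw y hy hxy hm'
    obtain ⟨u, hu, h1, h2⟩ := hm x hx hxw
    have hux := h1.ne
    have hub : (m x).bodd = !(m u).bodd := by rw [h2, Nat.bodd_succ]
    have hmax : max (m x) (m u) = m x := by omega
    have hxp : x ≠ p := fun h => hpn (h ▸ .inl hx)
    have hup : u ≠ p := fun h => hpn (h ▸ .inl hu)
    have hyp : y ≠ p := fun h => hpn (h ▸ hy)
    have hyu : y ≠ u := by
      rintro rfl
      simp [hub] at hm'
    refine IsAltList.altConn [u, p, y] (m x).bodd ?_ (by simp) (by grind)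
    simp only [IsAltList, f, hxp, hup, hyp, if_true, if_false, hmax]
    have := hp y hy
    have := hp u (.inl hu)
    grind [Adj.symm]
  have key2 : ∀ x ∈ H ∪ E, ∀ y ∈ H ∪ E, (m x).bodd ≠ (m y).bodd →
      G.AltConn f x y (insert p (H ∪ E)) := by
    intro x hx y hy hxy
    have hxp : x ≠ p := fun h => hpn (h ▸ hx)
    have hyp : y ≠ p := fun h => hpn (h ▸ hy)
    refine IsAltList.altConn [p, y] (m x).bodd ?_ (by simp) (by grind)
    simp only [IsAltList, f, hxp, hyp, if_true, if_false]
    have := hp y hy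
    have := hp x hx
    grind [Adj.symm]
  refine ⟨f, hf, ?_, false, ?_⟩
  · intro x hx y hy hxy
    rcases hx with rfl | hx
    · exact .of_adj (hp y (hy.resolve_left hxy.symm)) (.inl rfl) hy
    rcases hy with rfl | hy
    · exact .of_adj (hp x hx).symm (.inr hx) (.inl rfl)
    by_cases hb : (m x).bodd = (m y).bodd
    · by_cases hxw : x ∈ H ∧ x ≠ w
      · exact key x hxw.1 hxw.2 y hy hxy hb
      · have hyw : y ∈ H ∧ y ≠ w := by
          rcases hx with hx | hx <;> rcases hy with hy | hy
          · grind
          · have : x = w := by grind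
            rw [this, hmE y hy, hmw] at hb
            simp at hb
          · refine ⟨hy, ?_⟩
            rintro rfl
            rw [hmE x hx, hmw] at hb
            simp at hb
          · exact (hxy (hE hx hy)).elim
        exact (key y hyw.1 hyw.2 x hx hxy.symm hb.symm).symm hf
    · exact key2 x hx y hy hb
  · intro x hx hxw
    have hwp : w ≠ p := fun h => hpn (h ▸ .inl hw)
    have hpw := (hH w hw).symm
    rcases hx with rfl | hx
    · refine (IsAltList.altReach [x] ?_).mono (by grind)
      simp [IsAltList, f, hwp, hmw, hpw]
    have hxp : x ≠ p := fun h => hpn (h ▸ hx)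
    have hpx := hp x hx
    cases hb : (m x).bodd
    · have hxH : x ∈ H := by
        refine hx.resolve_right fun hx => ?_
        rw [hmE x hx] at hb
        simp at hb
      obtain ⟨u, hu, h1, h2⟩ := hm x hxH hxw
      have hub : (m x).bodd = !(m u).bodd := by rw [h2, Nat.bodd_succ]
      have hmax : max (m u) (m x) = m x := by omega
      have hup : u ≠ p := fun h => hpn (h ▸ .inl hu)
      have huw : u ≠ w := by
        rintro rfl
        simp [hmw, hb] at hub
      have := hH u hu
      refine (IsAltList.altReach [p, u, x] ?_).mono (by grind)
      simp only [IsAltList, f, hxp, hup, hwp, if_true, if_false, hmax, hmw]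
      grind [Adj.symm, Nat.bodd_zero]
    · refine (IsAltList.altReach [p, x] ?_).mono (by grind)
      simp only [IsAltList, f, hxp, hwp, if_true, if_false, hmw]
      grind [Adj.symm, Nat.bodd_zero]

/-! ### Pendant vertices and cut vertices -/

/-- Either the vertices of `H` fall into two nonempty parts without edges between them, or there is
a distance function to `w` inside `H`. -/
theorem exists_split_or_level (G : SimpleGraph V) {H : Set V} {w : V} (hw : w ∈ H) :
    (∃ A B : Set V, A.Nonempty ∧ B.Nonempty ∧ Disjoint A B ∧ A ∪ B = H ∧
      ∀ a ∈ A, ∀ b ∈ B, ¬ G.Adj a b) ∨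
    ∃ l : V → ℕ, l w = 0 ∧ (∀ v ∈ H, v ≠ w → ∃ u ∈ H, G.Adj v u ∧ l v = l u + 1) ∧
      (∀ v ∈ H, l v = 0 → v = w) ∧ ∀ u ∈ H, ∀ v ∈ H, G.Adj u v → l u ≤ l v + 1 := by
  classical
  let G' : SimpleGraph V := 
    { Adj := fun a b => G.Adj a b ∧ a ∈ H ∧ b ∈ H
      symm := ⟨fun a b h => ⟨h.1.symm, h.2.2, h.2.1⟩⟩
      loopless := ⟨fun a h => h.1.ne rfl⟩ }
  by_cases hc : ∀ v ∈ H, G'.Reachable v w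
  · right
    refine ⟨fun v => G'.dist v w, by simp, ?_, ?_, ?_⟩
    · intro v hv hvw
      obtain ⟨p, hp⟩ := (hc v hv).exists_walk_length_eq_dist
      cases p with
      | nil => exact (hvw rfl).elim
      | @cons _ u _ h q =>
        refine ⟨u, h.2.2, h.1, ?_⟩
        have h1 := dist_le q
        have h2 : G'.dist v w ≤ G'.dist v u + G'.dist u w :=
          h.reachable.dist_triangle_left w
        rw [dist_eq_one_iff_adj.2 h] at h2
        simp only [Walk.length_cons] at hp
        beta_reduce
        omega
    · intro v hv h0
      exact (hc v hv).dist_eq_zero_iff.1 h0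
    · intro u hu v hv h
      have h' : G'.Adj u v := ⟨h, hu, hv⟩
      have h2 : G'.dist u w ≤ G'.dist u v + G'.dist v w := h'.reachable.dist_triangle_left w
      rw [dist_eq_one_iff_adj.2 h'] at h2
      beta_reduce
      omega
  · left
    push Not at hc
    obtain ⟨v, hv, hvw⟩ := hc
    refine ⟨{x ∈ H | G'.Reachable x w}, {x ∈ H | ¬ G'.Reachable x w}, ⟨w, hw, .rfl⟩, ⟨v, hv, hvw⟩,
      ?_, ?_, ?_⟩
    · exact Set.disjoint_left.2 fun x hx hx' => hx'.2 hx.2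
    · ext x
      by_cases h : G'.Reachable x w <;> simp [h]
    · rintro a ⟨ha, haw⟩ b ⟨hb, hbw⟩ hab
      have h' : G'.Adj b a := ⟨hab.symm, hb, ha⟩
      exact hbw (h'.reachable.trans haw)

theorem Connected.exists_adj_mem_not_mem {G : SimpleGraph V} (hG : G.Connected) {S : Set V}
    {x y : V} (hx : x ∈ S) (hy : y ∉ S) : ∃ a ∈ S, ∃ b, b ∉ S ∧ G.Adj a b := by
  obtain ⟨p⟩ := hG.preconnected x y
  obtain ⟨d, -, h1, h2⟩ := p.exists_boundary_dart S hx hy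
  exact ⟨_, h1, _, h2, d.adj⟩

/-- A path `p v w` may be hung on a set `R` with a two-colouring rooted at `w`. -/
theorem hasAltColoring_of_tail {G : SimpleGraph V} {R : Set V} {p v w : V} (hw : w ∈ R)
    (hR : G.RootedAlt R w) (hv : v ∉ R) (hp : p ∉ R) (hpv : G.Adj p v) (hvw : G.Adj v w)
    (hall : ∀ x, x = p ∨ x = v ∨ x ∈ R) : G.HasAltColoring := by
  refine ((hR.adjoin hw hv hvw).adjoin (Set.mem_insert _ _) (v := p) ?_ hpv).hasAltColoring ?_
  · rintro (h | h)
    · exact hpv.ne h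
    · exact hp h
  · intro x
    simpa using hall x

/-- In the complement `p` is a hub for all vertices but `v`. If the complement is connected on the
remaining vertices, the hub colouring applies and `v` is hung on. Otherwise these vertices split
into parts completely joined in `G`, which gives a complete bipartite graph with a tail unless one
part is a single vertex `d`; that exception is resolved by splitting the other part `B` again. -/
theorem hasAltColoring_or_compl_of_pendant [Fintype V] (G : SimpleGraph V)
    (hn : 5 ≤ Fintype.card V) (hG : G.Connected) (hGc : Gᶜ.Connected) {p v : V}
    (hp : ∀ z, G.Adj p z ↔ z = v) : G.HasAltColoring ∨ Gᶜ.HasAltColoring := by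
  classical
  have hpv : G.Adj p v := (hp v).2 rfl
  have hcard : ∀ s : Finset V, s.card < 5 → ∃ z, z ∉ s := by
    intro s hs
    by_contra! h
    have : s = Finset.univ := Finset.eq_univ_iff_forall.2 h
    rw [this, Finset.card_univ] at hs
    omega
  have hpc : ∀ z, z ≠ p → z ≠ v → Gᶜ.Adj p z := by
    intro z h1 h2
    rw [compl_adj]
    exact ⟨h1.symm, fun h => h2 ((hp z).1 h)⟩
  obtain ⟨z0, hz0⟩ := hcard {p, v} (Finset.card_le_two.trans_lt (by norm_num))
  simp only [Finset.mem_insert, Finset.mem_singleton, not_or] at hz0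
  obtain ⟨w, hwv, hwp⟩ : ∃ w, G.Adj v w ∧ w ≠ p := by
    obtain ⟨a, ha, b, hb, hab⟩ := hG.exists_adj_mem_not_mem (S := {p, v}) (x := v) (y := z0)
      (by simp) (by simpa using hz0)
    simp only [Set.mem_insert_iff, Set.mem_singleton_iff, not_or] at ha hb
    rcases ha with rfl | rfl
    · exact (hb.2 ((hp b).1 hab)).elim
    · exact ⟨b, hab, hb.1⟩
  obtain ⟨u, huv⟩ : ∃ u, Gᶜ.Adj v u := by
    obtain ⟨a, ha, b, hb, hab⟩ := hGc.exists_adj_mem_not_mem (S := {v}) (x := v) (y := z0)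
      (by simp) (by simpa using hz0.2)
    rw [Set.mem_singleton_iff] at ha
    exact ⟨b, ha ▸ hab⟩
  have hup : u ≠ p := by
    rintro rfl
    exact ((compl_adj _ _ _).1 huv).2 hpv.symm
  -- the graph `G` has the tail `p v w` on a complete bipartite graph
  have split : ∀ R S : Set V, R.Nontrivial → S.Nontrivial → (∀ a ∈ R, ∀ b ∈ S, G.Adj a b) →
      (∀ x, x ∈ R ∪ S ↔ x ≠ p ∧ x ≠ v) → G.HasAltColoring := by
    intro R S hR hS hRS hall
    have hw : w ∈ R ∪ S := (hall w).2 ⟨hwp, hwv.ne.symm⟩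
    refine hasAltColoring_of_tail hw (rootedAlt_of_complete_bipartite hRS hR hS hw)
      (fun h => ((hall v).1 h).2 rfl) (fun h => ((hall p).1 h).1 rfl) hpv hwv ?_
    intro x
    by_cases h1 : x = p
    · exact .inl h1
    by_cases h2 : x = v
    · exact .inr (.inl h2)
    · exact .inr (.inr ((hall x).2 ⟨h1, h2⟩))
  rcases exists_split_or_level Gᶜ (H := {x | x ≠ p ∧ x ≠ v}) (w := u) ⟨hup, huv.ne.symm⟩ with
    ⟨A, B, hA, hB, hAB, hu, hne⟩ | ⟨l, hl0, hl, -, -⟩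
  · have hall : ∀ x, x ∈ A ∪ B ↔ x ≠ p ∧ x ≠ v := by
      intro x
      rw [hu]
      rfl
    have hadj : ∀ a ∈ A, ∀ b ∈ B, G.Adj a b := by
      intro a ha b hb
      by_contra h
      exact hne a ha b hb ((compl_adj _ _ _).2 ⟨fun hab => Set.disjoint_left.1 hAB ha (hab ▸ hb), h⟩)
    clear hu hne
    wlog hAd : A.Subsingleton generalizing A B
    · by_cases hBd : B.Subsingleton
      · exact this B A hB hA hAB.symm (by rwa [Set.union_comm])
          (fun b hb a ha => (hadj a ha b hb).symm) hBd
      · exact .inl (split A B (Set.not_subsingleton_iff.1 hAd) (Set.not_subsingleton_iff.1 hBd)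
          hadj hall)
    obtain ⟨d, hd⟩ := hA
    obtain rfl : A = {d} := hAd.eq_singleton_of_mem hd
    clear hAd hd
    have hdB : d ∉ B := fun h => Set.disjoint_left.1 hAB rfl h
    have hdpv := (hall d).1 (by simp)
    have hBpv : ∀ b ∈ B, b ≠ p ∧ b ≠ v := fun b hb => (hall b).1 (.inr hb)
    have hdB' : ∀ b ∈ B, G.Adj d b := fun b hb => hadj d rfl b hb
    have hmem : ∀ x, x ≠ p → x ≠ v → x ≠ d → x ∈ B := fun x h1 h2 h3 =>
      ((hall x).2 ⟨h1, h2⟩).resolve_left h3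
    have hBn : B.Nontrivial := by
      obtain ⟨b, hb⟩ := hB
      -- The fifth vertex is what makes `B` have two elements.
      obtain ⟨z, hz⟩ := hcard {p, v, d, b} (Finset.card_le_four.trans_lt (by norm_num))
      simp only [Finset.mem_insert, Finset.mem_singleton, not_or] at hz
      exact ⟨b, hb, z, hmem z hz.1 hz.2.1 hz.2.2.1, fun h => hz.2.2.2 h.symm⟩
    by_cases hvB : ∃ b ∈ B, Gᶜ.Adj v b
    · obtain ⟨b, hb, hvb⟩ := hvB
      rcases exists_split_or_level Gᶜ hb with ⟨C, D, hC, hD, hCD, hu, hne⟩ | ⟨l, hl0, hl, -, -⟩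
      · have hadj' : ∀ a ∈ C, ∀ b ∈ D, G.Adj a b := by
          intro a ha b hb
          by_contra h
          exact hne a ha b hb
            ((compl_adj _ _ _).2 ⟨fun hab => Set.disjoint_left.1 hCD ha (hab ▸ hb), h⟩)
        clear hne
        -- Since `d` is joined in `G` to all of `B`, it can be moved to the smaller side, so only
        -- one of `C`, `D` needs two elements.
        have big : ∀ C D : Set V, C ∪ D = B → C.Nontrivial → D.Nonempty →
            (∀ a ∈ C, ∀ b ∈ D, G.Adj a b) → G.HasAltColoring := by
          intro C D hu hC hD h
          refine split C (insert d D) hC ?_ ?_ ?_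
          · obtain ⟨z, hz⟩ := hD
            exact ⟨d, .inl rfl, z, .inr hz, fun hdz => hdB (hu ▸ .inr (hdz ▸ hz))⟩
          · rintro a ha b (rfl | hb)
            · exact (hdB' a (hu ▸ .inl ha)).symm
            · exact h a ha b hb
          · intro x
            rw [← hall x, ← hu]
            simp only [Set.mem_union, Set.mem_insert_iff, Set.mem_singleton_iff]
            tauto
        by_cases hCn : C.Nontrivial
        · exact .inl (big C D hu hCn hD hadj')
        by_cases hDn : D.Nontrivial
        · exact .inl (big D C (by rwa [Set.union_comm]) hDn hC
            fun a ha b hb => (hadj' b hb a ha).symm)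
        -- here `G` is a triangle with a tail
        rw [Set.not_nontrivial_iff] at hCn hDn
        obtain ⟨c, hc⟩ := hC
        obtain ⟨e, he⟩ := hD
        obtain rfl : C = {c} := hCn.eq_singleton_of_mem hc
        obtain rfl : D = {e} := hDn.eq_singleton_of_mem he
        have hce : G.Adj c e := hadj' c rfl e rfl
        have hdc : G.Adj d c := hdB' c (hu ▸ .inl rfl)
        have hde : G.Adj d e := hdB' e (hu ▸ .inr rfl)
        have hall' : ∀ x, x = p ∨ x = v ∨ x = d ∨ x = c ∨ x = e := by
          intro x
          by_contra! h
          have := hmem x h.1 h.2.1 h.2.2.1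
          rw [← hu] at this
          rcases this with h' | h'
          · exact h.2.2.2.1 h'
          · exact h.2.2.2.2 h'
        -- The triangle `w a b` is treated as the hub `a` over the edge `wb`, with levels 0 and 1.
        have tri : ∀ a b, G.Adj a b → G.Adj w a → G.Adj w b →
            (∀ x, x = p ∨ x = v ∨ x = w ∨ x = a ∨ x = b) → a ≠ p → b ≠ p → a ≠ v → b ≠ v →
            G.HasAltColoring := by
          intro a b hab hwa hwb hall hap hbp hav hbv
          refine hasAltColoring_of_tail (w := w) (R := insert a ({w, b} ∪ ∅)) (by simp)
            (rootedAlt_of_hub (by simp) ?_ (by simp) (by simp) (by simp)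
              (fun x => if x = w then 0 else 1) ?_ (by simp)) ?_ ?_ hpv hwv ?_
          · rintro h (rfl | rfl)
            exacts [hwa.symm, hab]
          · rintro x (rfl | rfl) hx
            · exact (hx rfl).elim
            · exact ⟨w, by simp, hwb.symm, by simp [hwb.ne.symm]⟩
          · simp [hwv.ne, hav.symm, hbv.symm]
          · simp [hwp.symm, hap.symm, hbp.symm]
          · intro x
            have := hall x
            simp only [Set.mem_insert_iff, Set.union_empty, Set.mem_singleton_iff]
            tauto
        have hcB := hBpv c (hu ▸ .inl rfl)
        have heB := hBpv e (hu ▸ .inr rfl)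
        left
        rcases hall' w with h | h | rfl | rfl | rfl
        · exact (hwp h).elim
        · exact (hwv.ne h.symm).elim
        · exact tri c e hce hdc hde hall' hcB.1 heB.1 hcB.2 heB.2
        · exact tri d e hde hdc.symm hce (fun x => by have := hall' x; tauto) hdpv.1 heB.1 hdpv.2
            heB.2
        · exact tri d c hdc hde.symm hce.symm (fun x => by have := hall' x; tauto) hdpv.1 hcB.1
            hdpv.2 hcB.2
      · right
        -- In the complement `d` has no neighbour in `B`, so it enters as the extra vertex of the
        -- hub colouring.
        have h := rootedAlt_of_hub (G := Gᶜ) (H := B) (E := {d}) (p := p) hb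
          (fun h hh => hpc h (hBpv h hh).1 (hBpv h hh).2) (by simp)
          (by simpa using hpc d hdpv.1 hdpv.2) (by simpa using hdB) l hl hl0
        refine (h.adjoin (v := v) (by simp [hb]) ?_ hvb).hasAltColoring ?_
        · have : v ∉ B := fun h => (hBpv v h).2 rfl
          simp [hpv.ne.symm, hdpv.2.symm, this]
        · intro x
          have := hmem x
          simp only [Set.mem_insert_iff, Set.union_singleton]
          tauto
    · push Not at hvB
      left
      have hvB' : ∀ b ∈ B, G.Adj v b := by
        intro b hb
        by_contra h
        exact hvB b hb ((compl_adj _ _ _).2 ⟨(hBpv b hb).2.symm, h⟩)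
      have h := rootedAlt_of_complete_bipartite (G := G) (A := {v, d}) (B := B) (w := v)
        (by rintro a (rfl | rfl) b hb; exacts [hvB' b hb, hdB' b hb])
        ⟨v, by simp, d, by simp, hdpv.2.symm⟩ hBn (by simp)
      refine (h.adjoin (v := p) (by simp) ?_ hpv).hasAltColoring ?_
      · have : p ∉ B := fun h => (hBpv p h).1 rfl
        simp [hpv.ne, hdpv.1.symm, this]
      · intro x
        have := hmem x
        simp only [Set.mem_insert_iff, Set.mem_union, Set.mem_singleton_iff]
        tauto
  · right
    have h := rootedAlt_of_hub (G := Gᶜ) (H := {x | x ≠ p ∧ x ≠ v}) (E := ∅) (p := p) (w := u)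
      ⟨hup, huv.ne.symm⟩
      (fun h hh => hpc h hh.1 hh.2) (by simp) (by simp) (by simp) l hl hl0
    refine (h.adjoin (v := v) ?_ ?_ huv).hasAltColoring ?_
    · simp [hup, huv.ne.symm]
    · simp [hpv.ne.symm]
    · intro x
      simp only [Set.mem_insert_iff, Set.union_empty, Set.mem_ofPred_eq]
      tauto

/-- If both parts have two vertices, the complement contains a complete bipartite graph between
them, on which `v` is hung by a complement edge. A part with one vertex is a pendant vertex of `G`.
-/
theorem hasAltColoring_or_compl_of_cut [Fintype V] (G : SimpleGraph V)
    (hn : 5 ≤ Fintype.card V) (hG : G.Connected) (hGc : Gᶜ.Connected) {v : V} {A B : Set V}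
    (hA : A.Nonempty) (hB : B.Nonempty) (hAB : Disjoint A B) (hu : A ∪ B = {v}ᶜ)
    (hne : ∀ a ∈ A, ∀ b ∈ B, ¬ G.Adj a b) : G.HasAltColoring ∨ Gᶜ.HasAltColoring := by
  wlog hAB' : A.Nontrivial → B.Nontrivial generalizing A B
  · rw [Classical.not_imp] at hAB'
    exact this hB hA hAB.symm (by rwa [Set.union_comm])
      (fun b hb a ha h => hne a ha b hb h.symm) fun _ => hAB'.1
  have hvA : v ∉ A := fun h => by
    have : v ∈ ({v}ᶜ : Set V) := hu ▸ .inl h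
    exact this rfl
  by_cases hAn : A.Nontrivial
  · have hBn := hAB' hAn
    right
    obtain ⟨a, ha⟩ := hA
    obtain ⟨x, hx, w, hw, hvw⟩ := hGc.exists_adj_mem_not_mem (S := {v}) (x := v) (y := a) rfl
      (fun h => hvA (h ▸ ha))
    obtain rfl : x = v := hx
    have hw' : w ∈ A ∪ B := by rwa [hu]
    refine ((rootedAlt_of_complete_bipartite (G := Gᶜ) ?_ hAn hBn hw').adjoin hw' (v := x) ?_
      hvw).hasAltColoring ?_
    · intro a ha b hb
      exact (compl_adj _ _ _).2 ⟨fun h => Set.disjoint_left.1 hAB ha (h ▸ hb), hne a ha b hb⟩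
    · simp [hu]
    · simp [hu, em]
  · obtain ⟨p, hp⟩ := hA
    rw [Set.not_nontrivial_iff] at hAn
    obtain rfl : A = {p} := hAn.eq_singleton_of_mem hp
    have hpz : ∀ z, G.Adj p z → z = v := by
      intro z hz
      by_contra h
      have : z ∈ {p} ∪ B := by rw [hu]; exact h
      rcases this with h | h
      · exact hz.ne h.symm
      · exact hne p rfl z h hz
    obtain ⟨x, hx, w, hw, hpw⟩ := hG.exists_adj_mem_not_mem (S := {p}) (x := p) (y := v) rfl hvA
    obtain rfl : x = p := hx
    obtain rfl := hpz w hpw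
    exact hasAltColoring_or_compl_of_pendant G hn hG hGc (p := x) (v := w)
      fun z => ⟨hpz z, fun h => h ▸ hpw⟩

/-! ### A distinguished edge as a switch, and dominating edges -/

/-- The edge `xy` has the colour `true`, all other edges at `x` and `y` have the colour `false`. -/
structure IsDipole (G : SimpleGraph V) (f : V → V → Bool) (x y : V) : Prop where
  adj : G.Adj x y
  symm : ∀ u v, f u v = f v u
  edge : f x y = true
  left : ∀ z, G.Adj x z → z ≠ y → f x z = false
  right : ∀ z, G.Adj y z → z ≠ x → f y z = false

namespace IsDipole

variable {G : SimpleGraph V} {f : V → V → Bool} {x y u v w t : V}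

theorem swap (h : G.IsDipole f x y) : G.IsDipole f y x :=
  ⟨h.adj.symm, h.symm, by rw [h.symm, h.edge], h.right, h.left⟩

/-- This and the next lemmas list the routes through the switch. Entering `y`, crossing `xy` and
leaving `x` reads `false`, `true`, `false`, so the route may be prolonged at either end by edges
coloured `true`, then `false`, and so on. -/
theorem altConn_left (h : G.IsDipole f x y) (hu : G.Adj u y) (hux : u ≠ x) :
    G.AltConn f x u Set.univ := by
  refine IsAltList.altConn [y, u] true ?_ (by simp) (by simp)
  have := h.right u hu.symm hux
  simp [IsAltList, h.adj, h.edge, h.adj.ne, hux.symm, hu.symm, this, hu.ne.symm]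

theorem altConn_left_of_mid (h : G.IsDipole f x y) (hx : G.Adj x w) (hw : w ≠ y)
    (hv : G.Adj w v) (hvw : f w v = true) (hvx : v ≠ x) : G.AltConn f x v Set.univ := by
  refine IsAltList.altConn [w, v] false ?_ (by simp) (by simp)
  have := h.left w hx hw
  simp [IsAltList, hx, this, hv, hvw, hx.ne, hvx.symm, hv.ne]

theorem altConn_cross (h : G.IsDipole f x y) (hu : G.Adj u y) (hux : u ≠ x) (hv : G.Adj x v)
    (hvy : v ≠ y) (huv : u ≠ v) : G.AltConn f u v Set.univ := by
  refine IsAltList.altConn [y, x, v] false ?_ (by simp) (by simp)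
  have h1 := h.right u hu.symm hux
  have h2 := h.left v hv hvy
  have h3 := h.edge
  have := h.adj
  simp only [IsAltList, List.mem_cons, List.not_mem_nil, or_false, not_or]
  grind [Adj.symm, Adj.ne, h.symm]

theorem altConn_mid (h : G.IsDipole f x y) (hu : G.Adj u y) (hux : u ≠ x) (hw : G.Adj x w)
    (hwy : w ≠ y) (huw : u ≠ w) (hv : G.Adj w v) (hwv : f w v = true) (huv : u ≠ v)
    (hvx : v ≠ x) (hvy : v ≠ y) : G.AltConn f u v Set.univ := by
  refine IsAltList.altConn [y, x, w, v] false ?_ (by simp) (by simp)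
  have h1 := h.right u hu.symm hux
  have h2 := h.left w hw hwy
  have h3 := h.edge
  have := h.adj
  simp only [IsAltList, List.mem_cons, List.not_mem_nil, or_false, not_or]
  grind [Adj.symm, Adj.ne, h.symm]

theorem altConn_mid_mid (h : G.IsDipole f x y) (hu : G.Adj u t) (hut : f u t = true)
    (ht : G.Adj t y) (htx : t ≠ x) (hux : u ≠ x) (huy : u ≠ y) (hw : G.Adj x w)
    (hwy : w ≠ y) (hv : G.Adj w v) (hwv : f w v = true) (hvx : v ≠ x) (hvy : v ≠ y)
    (huw : u ≠ w) (huv : u ≠ v) (htw : t ≠ w) (htv : t ≠ v) : G.AltConn f u v Set.univ := by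
  refine IsAltList.altConn [t, y, x, w, v] true ?_ (by simp) (by simp)
  have h1 := h.right t ht.symm htx
  have h2 := h.left w hw hwy
  have h3 := h.edge
  have := h.adj
  simp only [IsAltList, List.mem_cons, List.not_mem_nil, or_false, not_or]
  grind [Adj.symm, Adj.ne, h.symm]

theorem altConn_mid_twice (h : G.IsDipole f x y) (hu : G.Adj u y) (hux : u ≠ x) (hw : G.Adj x w)
    (hwy : w ≠ y) (huw : u ≠ w) (ht : G.Adj w t) (hwt : f w t = true) (hut : u ≠ t) (htx : t ≠ x)
    (hty : t ≠ y) (hv : G.Adj t v) (htv : f t v = false) (huv : u ≠ v) (hvx : v ≠ x)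
    (hvy : v ≠ y) (hvw : v ≠ w) : G.AltConn f u v Set.univ := by
  refine IsAltList.altConn [y, x, w, t, v] false ?_ (by simp) (by simp)
  have h1 := h.right u hu.symm hux
  have h2 := h.left w hw hwy
  have h3 := h.edge
  have := h.adj
  simp only [IsAltList, List.mem_cons, List.not_mem_nil, or_false, not_or]
  grind [Adj.symm, Adj.ne, h.symm]

/-- The vertices not adjacent to `x` are joined to `x` by geodesics avoiding `y`. -/
theorem altConn_of_level (h : G.IsDipole f x y) (l : V → ℕ)
    (hl : ∀ v, v ≠ y → v ≠ x → ∃ u, u ≠ y ∧ G.Adj v u ∧ l v = l u + 1)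
    (hl0 : ∀ v, v ≠ y → l v = 0 → v = x) (hlx : l x = 0)
    (hladj : ∀ u, u ≠ y → ∀ v, v ≠ y → G.Adj u v → l u ≤ l v + 1)
    (hdom : ∀ z, z ≠ x → z ≠ y → G.Adj x z ∨ G.Adj y z)
    (hA : ∀ u v, u ≠ x → u ≠ y → v ≠ x → v ≠ y → ¬ G.Adj x u → ¬ G.Adj x v →
      f u v = !(max (l u) (l v)).bodd)
    (hAB : ∀ u v, u ≠ x → u ≠ y → v ≠ x → v ≠ y → ¬ G.Adj x u → G.Adj x v → f u v = true)
    (a b : V) (hax : a ≠ x) (hay : a ≠ y) (haxn : ¬ G.Adj x a) (hbx : b ≠ x) (hby : b ≠ y)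
    (hbxn : ¬ G.Adj x b) (hab : a ≠ b) : G.AltConn f a b Set.univ := by
  wlog hle : l a ≤ l b generalizing a b
  · exact (this b a hbx hby hbxn hax hay haxn hab.symm (by omega)).symm h.symm
  have hyb : G.Adj y b := (hdom b hbx hby).resolve_left hbxn
  -- The path descends from `a` to `x` by levels, crosses to `y` and ends at `b`. Taking `a` as the
  -- lower endpoint keeps `b` off the descent, because later vertices have smaller level.
  have main : ∀ k a, l a = k → a ≠ x → a ≠ y → ¬ G.Adj x a → a ≠ b → l a ≤ l b →
      G.AltReach f a (!k.bodd) b {z | z = x ∨ z = y ∨ z = b ∨ z = a ∨ l z < l a} := by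
    intro k
    induction k with
    | zero =>
      intro a hk hax hay
      exact (hax (hl0 a hay hk)).elim
    | succ k ih =>
      intro a hk hax hay haxn hab hle
      obtain ⟨u, huy, hau, hlu⟩ := hl a hay hax
      have huk : l u = k := by omega
      have hux : u ≠ x := by
        rintro rfl
        exact haxn hau.symm
      have hub : u ≠ b := by
        rintro rfl
        omega
      by_cases hu : G.Adj x u
      -- A neighbour of `x` has level 1, so `a` has level 2. The edge into it is `true`, which
      -- agrees with the parity rule and precedes the `false` edge to `x`.
      · have hk1 : k = 1 := by
          have h1 := hladj u huy x h.adj.ne hu.symm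
          have h2 : l u ≠ 0 := fun h => hux (hl0 u huy h)
          omega
        subst hk1
        have h1 := hAB a u hax hay hux huy haxn hu
        have h2 := h.left u hu huy
        have h3 := h.right b hyb hbx
        have h4 := h.edge
        have h5 := h.adj
        refine (IsAltList.altReach [u, x, y, b] ?_).mono ?_
        · simp only [IsAltList, List.mem_cons, List.not_mem_nil, or_false, not_or]
          have : (1 + 1).bodd = false := rfl
          grind [Adj.symm, Adj.ne, h.symm]
        · intro z hz
          simp only [List.mem_cons, List.not_mem_nil, or_false] at hz
          rcases hz with rfl | rfl | rfl | rfl | rfl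
          · simp
          · exact .inr (.inr (.inr (.inr (by omega))))
          · simp
          · simp
          · simp
      · have h1 := hA a u hax hay hux huy haxn hu
        have hmax : max (l a) (l u) = k + 1 := by omega
        rw [hmax] at h1
        have h2 := ih u huk hux huy hu hub (by omega)
        refine (AltReach.cons hau h1 (S := {z | z = x ∨ z = y ∨ z = b ∨ z = u ∨ l z < l u}) ?_
          ?_).mono ?_
        · rintro (h | h | h | h | h)
          · exact hax h
          · exact hay h
          · exact hab h
          · exact hau.ne h
          · omega
        · rwa [Nat.bodd_succ, Bool.not_not]
        · rintro z (rfl | h | h | h | rfl | h)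
          · simp
          · exact .inl h
          · exact .inr (.inl h)
          · exact .inr (.inr (.inl h))
          · exact .inr (.inr (.inr (.inr (by omega))))
          · exact .inr (.inr (.inr (.inr (by omega))))
  exact ⟨_, (main _ a rfl hax hay haxn hab hle).mono (Set.subset_univ _)⟩

end IsDipole

/-- A neighbour of `x` and another vertex adjacent to `y` are joined across the switch. The
remaining pairs are two non-neighbours of the same end; for these, the absence of cut vertices
provides distances to `x` in `G - y` and to `y` in `G - x`. Domination makes the two sets of
non-neighbours disjoint, so the two parity colourings do not interfere. -/
theorem hasAltColoring_of_dominating_edge {G : SimpleGraph V} {x y : V} (hxy : G.Adj x y)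
    (hdom : ∀ z, z ≠ x → z ≠ y → G.Adj x z ∨ G.Adj y z)
    (hcut : ∀ v : V, ¬ ∃ A B : Set V, A.Nonempty ∧ B.Nonempty ∧ Disjoint A B ∧ A ∪ B = {v}ᶜ ∧
      ∀ a ∈ A, ∀ b ∈ B, ¬ G.Adj a b) : G.HasAltColoring := by
  classical
  obtain ⟨l, hl0, hl, hl1, hl2⟩ :=
    (exists_split_or_level G (H := {y}ᶜ) (w := x) hxy.ne).resolve_left (hcut y)
  obtain ⟨m, hm0, hm, hm1, hm2⟩ :=
    (exists_split_or_level G (H := {x}ᶜ) (w := y) hxy.ne.symm).resolve_left (hcut x)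
  let f : V → V → Bool := fun u v =>
    if u = x ∨ u = y then decide (v = x ∨ v = y) else if v = x ∨ v = y then false
    else if ¬ G.Adj x u ∧ ¬ G.Adj x v then !(max (l u) (l v)).bodd
    else if ¬ G.Adj y u ∧ ¬ G.Adj y v then !(max (m u) (m v)).bodd else true
  have hf : G.IsDipole f x y := by
    refine ⟨hxy, ?_, by simp [f], ?_, ?_⟩
    · intro u v
      simp only [f, max_comm (l u), max_comm (m u), and_comm (a := ¬ G.Adj x u),
        and_comm (a := ¬ G.Adj y u)]
      grind
    · intro z hz hzy
      simp [f, hz.ne.symm, hzy]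
    · intro z hz hzx
      simp [f, hz.ne.symm, hzx]
  have hA := hf.altConn_of_level l (fun v h1 h2 => by simpa using hl v h1 h2) (by simpa using hl1)
    hl0 (by simpa using hl2) hdom
    (by
      intro u v h1 h2 h3 h4 h5 h6
      simp [f, h1, h2, h3, h4, h5, h6])
    (by
      intro u v h1 h2 h3 h4 h5 h6
      have := (hdom u h1 h2).resolve_left h5
      simp [f, h1, h2, h3, h4, h6, this])
  have hB := hf.swap.altConn_of_level m (fun v h1 h2 => by simpa using hm v h1 h2)
    (by simpa using hm1) hm0 (by simpa using hm2) (fun z h1 h2 => (hdom z h2 h1).symm)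
    (by
      intro u v h1 h2 h3 h4 h5 h6
      have := (hdom u h2 h1).resolve_right h5
      simp [f, h1, h2, h3, h4, h5, h6, this])
    (by
      intro u v h1 h2 h3 h4 h5 h6
      have := (hdom u h2 h1).resolve_right h5
      simp [f, h1, h2, h3, h4, h6, this])
  have hx : ∀ v, v ≠ x → G.AltConn f x v Set.univ := by
    intro v hvx
    by_cases h : G.Adj x v
    · exact .of_adj h trivial trivial
    · have hvy : v ≠ y := by
        rintro rfl
        exact h hxy
      exact hf.altConn_left ((hdom v hvx hvy).resolve_left h).symm hvx
  have hy : ∀ v, v ≠ y → G.AltConn f y v Set.univ := by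
    intro v hvy
    by_cases h : G.Adj y v
    · exact .of_adj h trivial trivial
    · have hvx : v ≠ x := by
        rintro rfl
        exact h hxy.symm
      exact hf.swap.altConn_left ((hdom v hvx hvy).resolve_right h).symm hvy
  refine ⟨f, hf.symm, ?_⟩
  intro u v huv
  by_cases hux : u = x
  · exact hux ▸ hx v (hux ▸ huv.symm)
  by_cases huy : u = y
  · exact huy ▸ hy v (huy ▸ huv.symm)
  by_cases hvx : v = x
  · exact (hvx ▸ hx u hux).symm hf.symm
  by_cases hvy : v = y
  · exact (hvy ▸ hy u huy).symm hf.symm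
  by_cases h1 : G.Adj x u
  · by_cases h2 : G.Adj y v
    · exact hf.swap.altConn_cross h1.symm huy h2 hvx huv
    · by_cases h3 : G.Adj y u
      · exact hf.altConn_cross h3.symm hux ((hdom v hvx hvy).resolve_right h2) hvy huv
      · exact hB u v huy hux h3 hvy hvx h2 huv
  · by_cases h2 : G.Adj x v
    · exact hf.altConn_cross ((hdom u hux huy).resolve_left h1).symm hux h2 hvy huv
    · exact hA u v hux huy h1 hvx hvy h2 huv

/-! ### Graphs with many common neighbours, and edges dominating all but one vertex -/

/-- Two colours suffice if any two distinct nonadjacent vertices have two common neighbours. -/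
theorem hasAltColoring_of_two_common {G : SimpleGraph V} {x y : V} (hxy : G.Adj x y)
    (hcom : ∀ u v, u ≠ v → ¬ G.Adj u v → ∀ t, ∃ w, w ≠ t ∧ G.Adj u w ∧ G.Adj w v) :
    G.HasAltColoring := by
  classical
  -- Edges away from the switch are all `true`, so a route can be prolonged by one edge at each end.
  let f : V → V → Bool := fun u v => decide ((u = x ∨ u = y) ↔ (v = x ∨ v = y))
  have hf : G.IsDipole f x y := by
    refine ⟨hxy, ?_, by simp [f], ?_, ?_⟩
    · intro u v
      simp only [f, iff_comm]
    · intro z hz hzy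
      simp [f, hz.ne.symm, hzy]
    · intro z hz hzx
      simp [f, hz.ne.symm, hzx]
  have hft : ∀ u v, u ≠ x → u ≠ y → v ≠ x → v ≠ y → f u v = true := by
    intro u v h1 h2 h3 h4
    simp [f, h1, h2, h3, h4]
  clear_value f
  have half : ∀ x y, G.IsDipole f x y →
      (∀ u v, u ≠ x → u ≠ y → v ≠ x → v ≠ y → f u v = true) →
      (∀ v, v ≠ x → G.AltConn f x v Set.univ) ∧
      ∀ u v, u ≠ x → u ≠ y → v ≠ x → v ≠ y → u ≠ v → G.Adj y u → G.AltConn f u v Set.univ := by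
    intro x y hf hft
    constructor
    · intro v hvx
      by_cases h1 : G.Adj x v
      · exact .of_adj h1 trivial trivial
      obtain ⟨w, hwy, hxw, hwv⟩ := hcom x v hvx.symm h1 y
      have hvy : v ≠ y := by
        rintro rfl
        exact h1 hf.adj
      exact hf.altConn_left_of_mid hxw hwy hwv (hft w v hxw.ne.symm hwy hvx hvy) hvx
    · intro u v hux huy hvx hvy huv hyu
      by_cases h1 : G.Adj x v
      · exact hf.altConn_cross hyu.symm hux h1 hvy huv
      by_cases hadj : G.Adj u v
      · exact .of_adj hadj trivial trivial
      obtain ⟨w, hwy, hxw, hwv⟩ := hcom x v hvx.symm h1 y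
      refine hf.altConn_mid hyu.symm hux hxw hwy ?_ hwv (hft w v hxw.ne.symm hwy hvx hvy) huv hvx
        hvy
      rintro rfl
      exact hadj hwv
  obtain ⟨hx, hy'⟩ := half x y hf hft
  obtain ⟨hy, hx'⟩ := half y x hf.swap fun u v h1 h2 h3 h4 => hft u v h2 h1 h4 h3
  refine ⟨f, hf.symm, ?_⟩
  intro u v huv
  by_cases hux : u = x
  · exact hux ▸ hx v (hux ▸ huv.symm)
  by_cases huy : u = y
  · exact huy ▸ hy v (huy ▸ huv.symm)
  by_cases hvx : v = x
  · exact (hvx ▸ hx u hux).symm hf.symm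
  by_cases hvy : v = y
  · exact (hvy ▸ hy u huy).symm hf.symm
  by_cases h1 : G.Adj y u
  · exact hy' u v hux huy hvx hvy huv h1
  by_cases h2 : G.Adj x u
  · exact hx' u v huy hux hvy hvx huv h2
  by_cases h3 : G.Adj y v
  · exact (hy' v u hvx hvy hux huy huv.symm h3).symm hf.symm
  by_cases h4 : G.Adj x v
  · exact (hx' v u hvy hvx huy hux huv.symm h4).symm hf.symm
  by_cases hadj : G.Adj u v
  · exact .of_adj hadj trivial trivial
  -- Both ends need an intermediate vertex, on the route `u t y x w v`. The second common neighbour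
  -- is used to get `w` different from `t`.
  obtain ⟨t, -, hut, hty⟩ := hcom u y huy (fun h => h1 h.symm) x
  obtain ⟨w, hwt, hxw, hwv⟩ := hcom x v (Ne.symm hvx) h4 t
  have htx : t ≠ x := by
    rintro rfl
    exact h2 hut.symm
  have hwy : w ≠ y := by
    rintro rfl
    exact h3 hwv
  refine hf.altConn_mid_mid hut (hft u t hux huy htx hty.ne) hty htx hux huy hxw hwy hwv
    (hft w v hxw.ne.symm hwy hvx hvy) hvx hvy ?_ huv hwt.symm ?_
  · rintro rfl
    exact h2 hxw
  · rintro rfl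
    exact h3 hty.symm

/-- `a` is a neighbour of `y`, different from `x` and not adjacent to it. -/
def IsPrivate (G : SimpleGraph V) (x y a : V) : Prop :=
  a ≠ x ∧ G.Adj y a ∧ ¬ G.Adj x a

/-- `a` has a common neighbour with `x` other than `y`. -/
def HasDetour (G : SimpleGraph V) (x y a : V) : Prop :=
  ∃ w, w ≠ y ∧ G.Adj x w ∧ G.Adj w a

/-- `a` is private and has no detour, and neither has any private neighbour of `a`. -/
def IsStuck (G : SimpleGraph V) (x y a : V) : Prop :=
  G.IsPrivate x y a ∧ ¬ G.HasDetour x y a ∧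
    ∀ b, G.IsPrivate x y b → G.Adj a b → ¬ G.HasDetour x y b

/-- Consider a common neighbour of `a` and `b`. If it were dominated by `x` or `y`, it would be a
detour for `a`, or a private neighbour of `a` having `b` as a detour. Hence it is the undominated
vertex `d`. -/
theorem IsStuck.adj {G : SimpleGraph V} {x y d a b : V} (ha : G.IsStuck x y a)
    (hdom : ∀ z, z ≠ x → z ≠ y → z ≠ d → G.Adj x z ∨ G.Adj y z)
    (hcom : ∀ u v, u ≠ v → ¬ G.Adj u v → ∃ w, G.Adj u w ∧ G.Adj w v)
    (hb : G.IsPrivate y x b) : G.Adj d a := by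
  obtain ⟨⟨hax, hya, hxa⟩, h1, h2⟩ := ha
  obtain ⟨hby, hxb, hyb⟩ := hb
  have hab : a ≠ b := by
    rintro rfl
    exact hyb hya
  obtain ⟨w, haw, hwb⟩ := hcom a b hab fun h => h1 ⟨b, hby, hxb, h.symm⟩
  by_cases hwd : w = d
  · exact hwd ▸ haw.symm
  have hwy : w ≠ y := by
    rintro rfl
    exact hyb hwb
  have hwx : w ≠ x := by
    rintro rfl
    exact hxa haw.symm
  by_cases hxw : G.Adj x w
  · exact (h1 ⟨w, hwy, hxw, haw.symm⟩).elim
  · have hyw := (hdom w hwx hwy hwd).resolve_left hxw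
    exact (h2 w ⟨hwx, hyw, hxw⟩ haw ⟨b, hby, hxb, hwb.symm⟩).elim

/-- After crossing from `y` to `x`, the path reaches `b` through a detour of `b`, or through a
detour of a private neighbour of `b`, or, if `b` is stuck, through `d`. The edge from `d` to the
single exceptional vertex `s` need not be `false`, since `s` can be chosen as the starting vertex of
the path. -/
theorem IsDipole.altConn_of_private {G : SimpleGraph V} {f : V → V → Bool} {x y d s w : V}
    (h : G.IsDipole f x y) (hdx : d ≠ x) (hdy : d ≠ y) (hyd : ¬ G.Adj y d)
    (hwy : w ≠ y) (hxw : G.Adj x w) (hwd : G.Adj w d) (hfwd : f w d = true)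
    (hstuck : ∀ a, G.IsStuck x y a → G.Adj d a)
    (hs : ∀ a, G.IsStuck x y a → a ≠ s → f d a = false)
    (hAA : ∀ a b, G.IsPrivate x y a → G.IsPrivate x y b → f a b = false)
    (hAB : ∀ w a, w ≠ y → G.Adj x w → G.IsPrivate x y a → f w a = true)
    (a b : V) (ha : G.IsPrivate x y a) (hb : G.IsPrivate x y b) (hab : a ≠ b) :
    G.AltConn f a b Set.univ := by
  wlog hbs : b ≠ s generalizing a b
  · exact (this b a hb ha hab.symm (by grind)).symm h.symm
  obtain ⟨hax, hya, hxa⟩ := id ha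
  obtain ⟨hbx, hyb, hxb⟩ := id hb
  by_cases h1 : G.HasDetour x y b
  · obtain ⟨w, hwy, hxw, hwb⟩ := h1
    exact h.altConn_mid hya.symm hax hxw hwy (fun haw => hxa (haw ▸ hxw)) hwb
      (hAB w b hwy hxw hb) hab hbx hyb.ne.symm
  by_cases h2 : ∃ c, G.IsPrivate x y c ∧ G.Adj b c ∧ G.HasDetour x y c
  · obtain ⟨c, hc, hbc, w, hwy, hxw, hwc⟩ := h2
    by_cases hac : a = c
    · exact .of_adj (hac ▸ hbc.symm) trivial trivial
    · exact h.altConn_mid_twice hya.symm hax hxw hwy (fun haw => hxa (haw ▸ hxw)) hwc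
        (hAB w c hwy hxw hc) hac hc.1 hc.2.1.ne.symm hbc.symm (hAA c b hc hb) hab hbx hyb.ne.symm
        (fun hbw => hxb (hbw ▸ hxw))
  · push Not at h2
    have hst : G.IsStuck x y b := ⟨hb, h1, h2⟩
    exact h.altConn_mid_twice hya.symm hax hxw hwy (fun haw => hxa (haw ▸ hxw)) hwd hfwd
      (fun had => hyd (had ▸ hya)) hdx hdy (hstuck b hst) (hs b hst hbs) hab hbx hyb.ne.symm
      (fun hbw => hxb (hbw ▸ hxw))

/-- Edges at `d` have two duties: they must be `false` towards stuck vertices to reach those, yet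
some must be `true` on each side to reach `d` itself. One stuck vertex per side is exempted, which
serves both. -/
theorem hasAltColoring_of_unique_missing {G : SimpleGraph V} {x y d a b : V} (hxy : G.Adj x y)
    (hdx : d ≠ x) (hdy : d ≠ y) (hxd : ¬ G.Adj x d) (hyd : ¬ G.Adj y d)
    (hdom : ∀ z, z ≠ x → z ≠ y → z ≠ d → G.Adj x z ∨ G.Adj y z)
    (hcom : ∀ u v, u ≠ v → ¬ G.Adj u v → ∃ w, G.Adj u w ∧ G.Adj w v)
    (ha : G.IsPrivate x y a) (hb : G.IsPrivate y x b) : G.HasAltColoring := by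
  classical
  have hdom' : ∀ z, z ≠ y → z ≠ x → z ≠ d → G.Adj y z ∨ G.Adj x z :=
    fun z h1 h2 h3 => (hdom z h2 h1 h3).symm
  have hsA : ∀ z, G.IsStuck x y z → G.Adj d z := fun z hz => hz.adj hdom hcom hb
  have hsB : ∀ z, G.IsStuck y x z → G.Adj d z := fun z hz => hz.adj hdom' hcom ha
  obtain ⟨s, hs⟩ : ∃ s, ∀ z, G.IsStuck x y z → G.IsStuck x y s := by
    by_cases h : ∃ s, G.IsStuck x y s
    · exact ⟨h.choose, fun _ _ => h.choose_spec⟩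
    -- With no stuck vertex on this side the exempted vertex is arbitrary.
    · exact ⟨x, fun z hz => (h ⟨z, hz⟩).elim⟩
  obtain ⟨t, ht⟩ : ∃ t, ∀ z, G.IsStuck y x z → G.IsStuck y x t := by
    by_cases h : ∃ s, G.IsStuck y x s
    · exact ⟨h.choose, fun _ _ => h.choose_spec⟩
    · exact ⟨x, fun z hz => (h ⟨z, hz⟩).elim⟩
  let R : V → Prop := fun z => (G.IsStuck x y z ∧ z ≠ s) ∨ (G.IsStuck y x z ∧ z ≠ t)
  let f : V → V → Bool := fun u v =>
    if u = x ∨ u = y then decide (v = x ∨ v = y) else if v = x ∨ v = y then false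
    else if u = d then decide (¬ R v) else if v = d then decide (¬ R u)
    else if ¬ G.Adj x u ∧ ¬ G.Adj x v then false
    else if ¬ G.Adj y u ∧ ¬ G.Adj y v then false else true
  have hf : G.IsDipole f x y := by
    refine ⟨hxy, ?_, by simp [f], ?_, ?_⟩
    · intro u v
      simp only [f, and_comm (a := ¬ G.Adj x u), and_comm (a := ¬ G.Adj y u)]
      grind
    · intro z hz hzy
      simp [f, hz.ne.symm, hzy]
    · intro z hz hzx
      simp [f, hz.ne.symm, hzx]
  have hfd : ∀ z, z ≠ x → z ≠ y → f d z = decide (¬ R z) := by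
    intro z h1 h2
    simp [f, h1, h2, hdx, hdy]
  have hAA : ∀ u v, G.IsPrivate x y u → G.IsPrivate x y v → f u v = false := by
    rintro u v ⟨h1, h2, h3⟩ ⟨h4, h5, h6⟩
    have h7 : u ≠ d := fun h => hyd (h ▸ h2)
    have h8 : v ≠ d := fun h => hyd (h ▸ h5)
    simp [f, h1, h2.ne.symm, h3, h4, h5.ne.symm, h6, h7, h8]
  have hBB : ∀ u v, G.IsPrivate y x u → G.IsPrivate y x v → f u v = false := by
    rintro u v ⟨h1, h2, h3⟩ ⟨h4, h5, h6⟩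
    have h7 : u ≠ d := fun h => hxd (h ▸ h2)
    have h8 : v ≠ d := fun h => hxd (h ▸ h5)
    simp [f, h1, h2.ne.symm, h3, h4, h5.ne.symm, h6, h7, h8]
  have hAB : ∀ w u, w ≠ y → G.Adj x w → G.IsPrivate x y u → f w u = true := by
    rintro u v h1 h2 ⟨h4, h5, h6⟩
    have h7 : u ≠ d := fun h => hxd (h ▸ h2)
    have h8 : v ≠ d := fun h => hyd (h ▸ h5)
    simp [f, h1, h2, h2.ne.symm, h4, h5, h5.ne.symm, h7, h8]
  have hBA : ∀ w u, w ≠ x → G.Adj y w → G.IsPrivate y x u → f w u = true := by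
    rintro u v h1 h2 ⟨h4, h5, h6⟩
    have h7 : u ≠ d := fun h => hyd (h ▸ h2)
    have h8 : v ≠ d := fun h => hxd (h ▸ h5)
    simp [f, h1, h2, h2.ne.symm, h4, h5, h5.ne.symm, h7, h8]
  clear_value f
  have hRA : ∀ z, G.IsStuck x y z → z ≠ s → f d z = false := by
    intro z hz hzs
    rw [hfd z hz.1.1 hz.1.2.1.ne.symm]
    simp [R, hz, hzs]
  have hRB : ∀ z, G.IsStuck y x z → z ≠ t → f d z = false := by
    intro z hz hzs
    rw [hfd z hz.1.2.1.ne.symm hz.1.1]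
    simp [R, hz, hzs]
  -- If stuck vertices exist on this side, the exempted one `t` leads to `d`. Otherwise any common
  -- neighbour of `x` and `d` does, since no edge at `d` on this side was made `false`.
  have hQ : ∃ w, w ≠ y ∧ G.Adj x w ∧ G.Adj w d ∧ f w d = true := by
    have hA : ∀ w, G.Adj x w → ¬ G.IsStuck x y w := fun w h1 h2 => h2.1.2.2 h1
    by_cases h : ∃ z, G.IsStuck y x z
    · obtain ⟨z, hz⟩ := h
      have h1 := ht z hz
      refine ⟨t, h1.1.1, h1.1.2.1, (hsB t h1).symm, ?_⟩
      rw [hf.symm, hfd t h1.1.2.1.ne.symm h1.1.1]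
      simp [R, hA t h1.1.2.1]
    · obtain ⟨w, h1, h2⟩ := hcom x d hdx.symm hxd
      have hwy : w ≠ y := fun h => hyd (h ▸ h2)
      refine ⟨w, hwy, h1, h2, ?_⟩
      rw [hf.symm, hfd w h1.ne.symm hwy]
      simp [R, hA w h1, not_exists.1 h w]
  have hP : ∃ w, w ≠ x ∧ G.Adj y w ∧ G.Adj w d ∧ f w d = true := by
    have hB : ∀ w, G.Adj y w → ¬ G.IsStuck y x w := fun w h1 h2 => h2.1.2.2 h1
    by_cases h : ∃ z, G.IsStuck x y z
    · obtain ⟨z, hz⟩ := h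
      have h1 := hs z hz
      refine ⟨s, h1.1.1, h1.1.2.1, (hsA s h1).symm, ?_⟩
      rw [hf.symm, hfd s h1.1.1 h1.1.2.1.ne.symm]
      simp [R, hB s h1.1.2.1]
    · obtain ⟨w, h1, h2⟩ := hcom y d hdy.symm hyd
      have hwx : w ≠ x := fun h => hxd (h ▸ h2)
      refine ⟨w, hwx, h1, h2, ?_⟩
      rw [hf.symm, hfd w hwx h1.ne.symm]
      simp [R, hB w h1, not_exists.1 h w]
  obtain ⟨q, hqy, hxq, hqd, hfq⟩ := hQ
  obtain ⟨p, hpx, hyp, hpd, hfp⟩ := hP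
  have hA := hf.altConn_of_private hdx hdy hyd hqy hxq hqd hfq hsA hRA hAA hAB
  have hB := hf.swap.altConn_of_private hdy hdx hxd hpx hyp hpd hfp hsB hRB hBB hBA
  have hx : ∀ v, v ≠ x → G.AltConn f x v Set.univ := by
    intro v hvx
    by_cases h : G.Adj x v
    · exact .of_adj h trivial trivial
    by_cases hvd : v = d
    · subst hvd
      exact hf.altConn_left_of_mid hxq hqy hqd hfq hdx
    · have hvy : v ≠ y := by
        rintro rfl
        exact h hxy
      exact hf.altConn_left ((hdom v hvx hvy hvd).resolve_left h).symm hvx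
  have hy : ∀ v, v ≠ y → G.AltConn f y v Set.univ := by
    intro v hvy
    by_cases h : G.Adj y v
    · exact .of_adj h trivial trivial
    by_cases hvd : v = d
    · subst hvd
      exact hf.swap.altConn_left_of_mid hyp hpx hpd hfp hdy
    · have hvx : v ≠ x := by
        rintro rfl
        exact h hxy.symm
      exact hf.swap.altConn_left ((hdom v hvx hvy hvd).resolve_right h).symm hvy
  have hd : ∀ u, u ≠ x → u ≠ y → u ≠ d → G.AltConn f u d Set.univ := by
    intro u hux huy hud
    by_cases h : G.Adj u d
    · exact .of_adj h trivial trivial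
    rcases hdom u hux huy hud with h1 | h1
    · exact hf.swap.altConn_mid h1.symm huy hyp hpx (fun h2 => h (h2 ▸ hpd)) hpd hfp hud hdy hdx
    · exact hf.altConn_mid h1.symm hux hxq hqy (fun h2 => h (h2 ▸ hqd)) hqd hfq hud hdx hdy
  refine ⟨f, hf.symm, ?_⟩
  intro u v huv
  by_cases hux : u = x
  · exact hux ▸ hx v (hux ▸ huv.symm)
  by_cases huy : u = y
  · exact huy ▸ hy v (huy ▸ huv.symm)
  by_cases hvx : v = x
  · exact (hvx ▸ hx u hux).symm hf.symm
  by_cases hvy : v = y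
  · exact (hvy ▸ hy u huy).symm hf.symm
  by_cases hvd : v = d
  · exact hvd ▸ hd u hux huy (hvd ▸ huv)
  by_cases hud : u = d
  · exact (hud ▸ hd v hvx hvy hvd).symm hf.symm
  by_cases h1 : G.Adj x u
  · by_cases h2 : G.Adj y v
    · exact hf.swap.altConn_cross h1.symm huy h2 hvx huv
    · have hxv := (hdom v hvx hvy hvd).resolve_right h2
      by_cases h3 : G.Adj y u
      · exact hf.altConn_cross h3.symm hux hxv hvy huv
      · exact hB u v ⟨huy, h1, h3⟩ ⟨hvy, hxv, h2⟩ huv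
  · have hyu := (hdom u hux huy hud).resolve_left h1
    by_cases h2 : G.Adj x v
    · exact hf.altConn_cross hyu.symm hux h2 hvy huv
    · exact hA u v ⟨hux, hyu, h1⟩ ⟨hvx, (hdom v hvx hvy hvd).resolve_left h2, h2⟩ huv

/-! ### One of the two graphs has a good two-colouring -/

/-- Two nonadjacent vertices without a common neighbour would form a dominating edge of the
complement. -/
theorem exists_common_of_no_dominating {G : SimpleGraph V}
    (h : ¬ ∃ x y, Gᶜ.Adj x y ∧ ∀ z, z ≠ x → z ≠ y → Gᶜ.Adj x z ∨ Gᶜ.Adj y z) (u v : V)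
    (huv : u ≠ v) (hn : ¬ G.Adj u v) : ∃ w, G.Adj u w ∧ G.Adj w v := by
  by_contra! hw
  refine h ⟨u, v, (compl_adj _ _ _).2 ⟨huv, hn⟩, fun z hzu hzv => ?_⟩
  by_contra! hz
  simp only [compl_adj, not_and, not_not] at hz
  exact hw z (hz.1 hzu.symm) (hz.2 hzv.symm).symm

theorem hasAltColoring_or_compl_hasAltColoring [Fintype V] (G : SimpleGraph V)
    (hn : 5 ≤ Fintype.card V) (hG : G.Connected) (hGc : Gᶜ.Connected) :
    G.HasAltColoring ∨ Gᶜ.HasAltColoring := by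
  have hcc : Gᶜᶜ = G := compl_compl G
  by_cases hcut : ∀ v : V, ¬ ∃ A B : Set V, A.Nonempty ∧ B.Nonempty ∧ Disjoint A B ∧
      A ∪ B = {v}ᶜ ∧ ∀ a ∈ A, ∀ b ∈ B, ¬ G.Adj a b
  swap
  · push Not at hcut
    obtain ⟨v, A, B, hA, hB, hAB, hu, hne⟩ := hcut
    exact hasAltColoring_or_compl_of_cut G hn hG hGc hA hB hAB hu hne
  by_cases hcut' : ∀ v : V, ¬ ∃ A B : Set V, A.Nonempty ∧ B.Nonempty ∧ Disjoint A B ∧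
      A ∪ B = {v}ᶜ ∧ ∀ a ∈ A, ∀ b ∈ B, ¬ Gᶜ.Adj a b
  swap
  · push Not at hcut'
    obtain ⟨v, A, B, hA, hB, hAB, hu, hne⟩ := hcut'
    have := hasAltColoring_or_compl_of_cut Gᶜ hn hGc (hcc.symm ▸ hG) hA hB hAB hu hne
    rw [hcc] at this
    exact this.symm
  by_cases hdom : ∃ x y, G.Adj x y ∧ ∀ z, z ≠ x → z ≠ y → G.Adj x z ∨ G.Adj y z
  · obtain ⟨x, y, hxy, hd⟩ := hdom
    exact .inl (hasAltColoring_of_dominating_edge hxy hd hcut)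
  by_cases hdom' : ∃ x y, Gᶜ.Adj x y ∧ ∀ z, z ≠ x → z ≠ y → Gᶜ.Adj x z ∨ Gᶜ.Adj y z
  · obtain ⟨x, y, hxy, hd⟩ := hdom'
    exact .inr (hasAltColoring_of_dominating_edge hxy hd hcut')
  have hcom := exists_common_of_no_dominating hdom'
  have hcom' := exists_common_of_no_dominating (G := Gᶜ) (by rwa [hcc])
  by_cases htwo : ∀ u v, u ≠ v → ¬ G.Adj u v → ∀ t, ∃ w, w ≠ t ∧ G.Adj u w ∧ G.Adj w v
  · have : Nontrivial V := Fintype.one_lt_card_iff_nontrivial.1 (by omega)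
    obtain ⟨x, y, hxy⟩ := exists_pair_ne V
    obtain ⟨a, -, b, -, hab⟩ := hG.exists_adj_mem_not_mem (S := {x}) (x := x) (y := y) rfl hxy.symm
    exact .inl (hasAltColoring_of_two_common hab htwo)
  push Not at htwo
  obtain ⟨u, v, huv, hadj, t, ht⟩ := htwo
  obtain ⟨hut, htv⟩ : G.Adj u t ∧ G.Adj t v := by
    obtain ⟨w, h1, h2⟩ := hcom u v huv hadj
    by_cases hwt : w = t
    · exact hwt ▸ ⟨h1, h2⟩
    · exact (ht w hwt h1 h2).elim
  -- Either `t` is the only neighbour of `u`, which is the pendant case, or another neighbour of `u`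
  -- is not joined to `v` in `G`, and is therefore private for the complement edge `uv`.
  have hpriv : ∀ u v, G.Adj u t → (∀ w, w ≠ t → G.Adj u w → ¬ G.Adj w v) → ¬ G.Adj u v →
      (G.HasAltColoring ∨ Gᶜ.HasAltColoring) ∨ ∃ a, Gᶜ.IsPrivate u v a := by
    intro u v hut ht hadj
    by_cases hp : ∀ z, G.Adj u z → z = t
    · exact .inl (hasAltColoring_or_compl_of_pendant G hn hG hGc fun z => ⟨hp z, fun h => h ▸ hut⟩)
    · push Not at hp
      obtain ⟨z, huz, hzt⟩ := hp
      refine .inr ⟨z, huz.ne.symm, (compl_adj _ _ _).2 ⟨?_, fun h => ht z hzt huz h.symm⟩,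
        fun h => ((compl_adj _ _ _).1 h).2 huz⟩
      rintro rfl
      exact hadj huz
  rcases hpriv u v hut ht hadj with h | ⟨a, ha⟩
  · exact h
  rcases hpriv v u htv.symm (fun w hw h1 h2 => ht w hw h2.symm h1.symm) (fun h => hadj h.symm) with
    h | ⟨b, hb⟩
  · exact h
  right
  refine hasAltColoring_of_unique_missing ((compl_adj _ _ _).2 ⟨huv, hadj⟩) hut.ne.symm htv.ne
    (fun h => ((compl_adj _ _ _).1 h).2 hut) (fun h => ((compl_adj _ _ _).1 h).2 htv.symm)
    ?_ hcom' ha hb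
  intro z hzu hzv hzt
  by_contra! hz
  simp only [compl_adj, not_and, not_not] at hz
  exact ht z hzt (hz.1 hzu.symm) (hz.2 hzv.symm).symm

/-! ### Upper bounds from the maximum degree -/

/-- A connected graph `F` has a connected spanning subgraph whose edges can be coloured properly
with as many colours as the largest degree of `F`. -/
theorem exists_connected_proper_edge_coloring [Fintype V] {F : SimpleGraph V} (hF : F.Connected)
    {k : ℕ} (hk : 0 < k) (hdeg : ∀ v, (F.neighborSet v).ncard ≤ k) :
    ∃ T ≤ F, ∃ f : Sym2 V → Fin k, T.Preconnected ∧
      ∀ a b c, T.Adj a b → T.Adj a c → b ≠ c → f s(a, b) ≠ f s(a, c) := by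
  classical
  have main : ∀ m, m + 1 ≤ Fintype.card V → ∃ S : Finset V, S.card = m + 1 ∧
      ∃ T ≤ F, ∃ f : Sym2 V → Fin k, (∀ a b, T.Adj a b → a ∈ S ∧ b ∈ S) ∧
      (∀ a ∈ S, ∀ b ∈ S, T.Reachable a b) ∧
      ∀ a b c, T.Adj a b → T.Adj a c → b ≠ c → f s(a, b) ≠ f s(a, c) := by
    intro m
    induction m with
    | zero =>
      intro _
      obtain ⟨r⟩ := hF.nonempty
      refine ⟨{r}, by simp, ⊥, bot_le, fun _ => ⟨0, hk⟩, by simp, by simp, by simp⟩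
    | succ m ih =>
      intro hm
      obtain ⟨S, hS, T, hT, f, h1, h2, h3⟩ := ih (by omega)
      obtain ⟨x, hx⟩ : S.Nonempty := Finset.card_pos.1 (by omega)
      obtain ⟨y, hy⟩ : ∃ y, y ∉ S := by
        by_contra! h
        rw [Finset.eq_univ_iff_forall.2 h, Finset.card_univ] at hS
        omega
      obtain ⟨a, ha, b, hb, hab⟩ := hF.exists_adj_mem_not_mem (S := (S : Set V)) hx hy
      rw [Finset.mem_coe] at ha hb
      -- The edge `ab` of `F` is not yet in `T`, so fewer than `k` edges of `T` meet `a` and some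
      -- colour is free there. The new vertex `b` has no earlier edge and imposes no condition.
      obtain ⟨i, hi⟩ : ∃ i, ∀ z, T.Adj a z → f s(a, z) ≠ i := by
        by_contra! h
        have hsub : T.neighborSet a ⊂ F.neighborSet a := by
          refine (Set.ssubset_iff_of_subset fun z hz => hT hz).2 ⟨b, hab, fun h => hb (h1 a b h).2⟩
        have hlt := (Set.ncard_lt_ncard hsub).trans_le (hdeg a)
        have himg : (fun z => f s(a, z)) '' T.neighborSet a = Set.univ := by
          ext i
          simpa using h i
        have hle := Set.ncard_image_le (f := fun z => f s(a, z)) (Set.toFinite (T.neighborSet a))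
        rw [himg, Set.ncard_univ, Nat.card_eq_fintype_card, Fintype.card_fin] at hle
        omega
      have hadj : ∀ p q, (T ⊔ edge a b).Adj p q ↔ T.Adj p q ∨ s(p, q) = s(a, b) := by
        intro p q
        rw [sup_adj, edge_adj, Sym2.eq_iff]
        have := hab.ne
        grind
      have hTb : ∀ z, ¬ T.Adj b z := fun z hz => hb (h1 _ _ hz).1
      have hTb' : ∀ z, ¬ T.Adj z b := fun z hz => hb (h1 _ _ hz).2
      refine ⟨insert b S, by rw [Finset.card_insert_of_notMem hb, hS], T ⊔ edge a b, ?_,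
        Function.update f s(a, b) i, ?_, ?_, ?_⟩
      · refine sup_le hT ?_
        rw [edge_le_iff]
        exact .inr hab
      · intro p q hpq
        rw [hadj, Sym2.eq_iff] at hpq
        have := h1 p q
        grind
      · have hle : T ≤ T ⊔ edge a b := le_sup_left
        have hba : (T ⊔ edge a b).Reachable b a :=
          Adj.reachable ((hadj b a).2 (.inr Sym2.eq_swap))
        have hto : ∀ p ∈ insert b S, (T ⊔ edge a b).Reachable p a := by
          intro p hp
          rcases Finset.mem_insert.1 hp with rfl | hp
          · exact hba
          · exact (h2 p hp a ha).mono hle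
        intro p hp q hq
        exact (hto p hp).trans (hto q hq).symm
      · have hold : ∀ p q, T.Adj p q → s(p, q) ≠ s(a, b) := by
          intro p q hpq h
          rw [Sym2.eq_iff] at h
          rcases h with ⟨-, rfl⟩ | ⟨rfl, -⟩
          · exact hTb' _ hpq
          · exact hTb _ hpq
        intro p q r hpq hpr hqr
        rw [hadj] at hpq hpr
        rcases hpq with hpq | hpq <;> rcases hpr with hpr | hpr
        · rw [Function.update_of_ne (hold _ _ hpq), Function.update_of_ne (hold _ _ hpr)]
          exact h3 p q r hpq hpr hqr
        · rw [Function.update_of_ne (hold _ _ hpq), hpr, Function.update_self]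
          rcases Sym2.eq_iff.1 hpr with ⟨rfl, -⟩ | ⟨rfl, -⟩
          · exact hi q hpq
          · exact (hTb q hpq).elim
        · rw [Function.update_of_ne (hold _ _ hpr), hpq, Function.update_self]
          rcases Sym2.eq_iff.1 hpq with ⟨rfl, -⟩ | ⟨rfl, -⟩
          · exact (hi r hpr).symm
          · exact (hTb r hpr).elim
        · exact (hqr (Sym2.congr_right.1 (hpq.trans hpr.symm))).elim
  have : Nonempty V := hF.nonempty
  have hpos : 0 < Fintype.card V := Fintype.card_pos
  obtain ⟨S, hS, T, hT, f, -, h2, h3⟩ := main (Fintype.card V - 1) (by omega)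
  have hSu : S = Finset.univ := by
    rw [← Finset.card_eq_iff_eq_univ]
    omega
  refine ⟨T, hT, f, fun a b => h2 a (by simp [hSu]) b (by simp [hSu]), h3⟩

/-- Passing to a subgraph `F` allows edges at a vertex of large degree to be discarded before the
degree bound is used. -/
theorem properConnectionNumber_le_of_degree_le [Fintype V] {F G : SimpleGraph V} (hFG : F ≤ G)
    (hF : F.Connected) {k : ℕ} (hk : 0 < k) (hdeg : ∀ v, (F.neighborSet v).ncard ≤ k) :
    G.properConnectionNumber ≤ k := by
  obtain ⟨T, hT, f, hc, hf⟩ := exists_connected_proper_edge_coloring hF hk hdeg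
  refine Nat.sInf_le ⟨EdgeLabeling.mk (fun x y _ => f s(x, y))
    (fun x y _ => by rw [Sym2.eq_swap]), fun x y _ => ?_⟩
  obtain ⟨p, hp⟩ := (hc x y).exists_isPath
  refine ⟨p.mapLe (hT.trans hFG), hp.mapLe _, ?_⟩
  have hmap : ((p.mapLe (hT.trans hFG)).darts.map fun d =>
      (EdgeLabeling.mk (G := G) (fun x y _ => f s(x, y))
        (fun x y _ => by rw [Sym2.eq_swap])).get d.fst d.snd d.adj) =
      (p.mapLe (hT.trans hFG)).edges.map f := by
    rw [Walk.edges, List.map_map]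
    rfl
  rw [hmap, Walk.edges_mapLe_eq_edges, Walk.edges, List.map_map, List.isChain_map]
  have h1 : p.darts.Pairwise fun d d' => d.edge ≠ d'.edge :=
    List.pairwise_map.mp hp.isTrail.edges_nodup
  have h2 := p.isChain_dartAdj_darts
  have h3 : p.darts.IsChain fun d d' => d.edge ≠ d'.edge ∧ T.DartAdj d d' :=
    List.isChain_iff_getElem.2 fun i hi =>
      ⟨List.isChain_iff_getElem.1 h1.isChain i hi, List.isChain_iff_getElem.1 h2 i hi⟩
  refine h3.imp ?_
  rintro ⟨⟨a, b⟩, hab⟩ ⟨⟨c, d⟩, hcd⟩ ⟨hne, hadj⟩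
  obtain rfl : b = c := hadj
  simp only [Function.comp, Dart.edge_mk] at hne ⊢
  rw [Sym2.eq_swap (a := a)]
  refine hf b a d hab.symm hcd ?_
  rintro rfl
  exact hne Sym2.eq_swap

theorem exists_coloring_properConnectionNumber [Finite V] {G : SimpleGraph V} (hG : G.Connected) :
    ∃ c : G.EdgeLabeling (Fin G.properConnectionNumber), c.IsProperPathColoring :=
  Nat.sInf_mem (exists_isProperPathColoring hG)

theorem two_le_properConnectionNumber [Finite V] {G : SimpleGraph V} (hG : G.Connected) {x y : V}
    (hxy : x ≠ y) (hadj : ¬ G.Adj x y) : 2 ≤ G.properConnectionNumber := by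
  obtain ⟨c, hc⟩ := exists_coloring_properConnectionNumber hG
  obtain ⟨p, hp, hch⟩ := hc x y hxy
  cases p with
  | nil => exact (hxy rfl).elim
  | cons h q =>
    cases q with
    | nil => exact (hadj h).elim
    | cons h' q =>
      simp only [Walk.darts_cons, List.map_cons, List.isChain_cons_cons] at hch
      by_contra hlt
      have : Subsingleton (Fin G.properConnectionNumber) := Fin.subsingleton_iff_le_one.2 (by omega)
      exact hch.1 (Subsingleton.elim _ _)

/-! ### The double star -/

/-- `G` is the double star with centres `v` and `u` in which `p` is the only leaf at `u`. -/
structure IsBroom (G : SimpleGraph V) (v u p : V) : Prop where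
  ne_vu : v ≠ u
  ne_up : u ≠ p
  ne_vp : v ≠ p
  adj_center : ∀ z, G.Adj v z ↔ z ≠ v ∧ z ≠ p
  adj_leaf : ∀ z, z ≠ v → z ≠ u → z ≠ p → ∀ y, G.Adj z y ↔ y = v
  adj_end : ∀ y, G.Adj p y ↔ y = u

theorem IsBroom.map {W : Type v} {G : SimpleGraph V} {H : SimpleGraph W} {v u p : V}
    (h : G.IsBroom v u p) (e : G ≃g H) : H.IsBroom (e v) (e u) (e p) := by
  have hs : ∀ x : W, e (e.symm x) = x := e.apply_symm_apply
  have hadj : ∀ (x : V) (z : W), H.Adj (e x) z ↔ G.Adj x (e.symm z) := by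
    intro x z
    rw [← e.map_adj_iff (v := x), hs]
  have heq : ∀ (x : V) (z : W), e.symm z = x ↔ z = e x := by
    intro x z
    constructor
    · rintro rfl
      rw [hs]
    · rintro rfl
      simp
  refine ⟨e.injective.ne h.ne_vu, e.injective.ne h.ne_up, e.injective.ne h.ne_vp, ?_, ?_, ?_⟩
  · intro z
    rw [hadj, h.adj_center, Ne, Ne, heq, heq]
  · intro z h1 h2 h3 y
    rw [← hs z, hadj, h.adj_leaf _ (by rwa [Ne, heq]) (by rwa [Ne, heq]) (by rwa [Ne, heq]), heq]
  · intro y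
    rw [hadj, h.adj_end, heq]

theorem isBroom_doubleStar (m : ℕ) :
    (doubleStar 2 m).IsBroom (Sum.inr none) (Sum.inl none) (Sum.inl (some 0)) := by
  refine ⟨by simp, by simp, by simp, ?_, ?_, ?_⟩
  · rintro ((_ | i) | (_ | i))
    · simp [doubleStar]
    · simp [doubleStar, Fin.fin_one_eq_zero i]
    · simp [doubleStar]
    · simp [doubleStar]
  · rintro ((_ | i) | (_ | i)) h1 h2 h3
    · simp at h2
    · exact (h3 (by rw [Fin.fin_one_eq_zero i])).elim
    · simp at h1
    · rintro ((_ | j) | (_ | j)) <;> simp [doubleStar]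
  · rintro ((_ | j) | (_ | j)) <;> simp [doubleStar]

theorem IsBroom.nonempty_iso [Fintype V] {G : SimpleGraph V} {v u p : V} (h : G.IsBroom v u p) :
    Nonempty (G ≃g doubleStar 2 (Fintype.card V - 2)) := by
  classical
  obtain ⟨h1, h2, h3, hv, hl, hp⟩ := h
  have hu : ∀ y, G.Adj u y ↔ y = v ∨ y = p := by
    intro y
    by_cases hyv : y = v
    · simp [hyv, (hv u).2 ⟨h1.symm, h2⟩, adj_comm]
    by_cases hyp : y = p
    · simp [hyp, G.adj_comm u p, (hp u).2 rfl]
    by_cases hyu : y = u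
    · simp [hyu, h1.symm, h2]
    · simp [G.adj_comm u y, hl y hyv hyu hyp, hyv, hyp, h1.symm]
  have hcard : Fintype.card {z // z ≠ v ∧ z ≠ u ∧ z ≠ p} = Fintype.card V - 2 - 1 := by
    have h4 := Finset.card_compl ({v, u, p} : Finset V)
    rw [Finset.card_eq_three.2 ⟨v, u, p, h1, h3, h2, rfl⟩] at h4
    rw [Fintype.card_subtype, Nat.sub_sub, ← h4]
    congr 1
    ext z
    simp
  let e := (Fintype.equivFinOfCardEq hcard).symm
  let g : Option (Fin (2 - 1)) ⊕ Option (Fin (Fintype.card V - 2 - 1)) → V :=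
    Sum.elim (fun o => o.elim u fun _ => p) (fun o => o.elim v fun i => (e i).1)
  have he1 : ∀ i, (e i).1 ≠ v := fun i => (e i).2.1
  have he2 : ∀ i, (e i).1 ≠ u := fun i => (e i).2.2.1
  have he3 : ∀ i, (e i).1 ≠ p := fun i => (e i).2.2.2
  have hg : Function.Bijective g := by
    constructor
    · rintro ((_ | i) | (_ | i)) ((_ | j) | (_ | j)) hij <;>
        simp only [g, Sum.elim_inl, Sum.elim_inr, Option.elim_none, Option.elim_some] at hij
      all_goals first
        | rfl
        | rw [Fin.fin_one_eq_zero i, Fin.fin_one_eq_zero j]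
        | rw [e.injective (Subtype.ext hij)]
        | grind
    · intro z
      by_cases hzv : z = v
      · exact ⟨.inr none, hzv.symm⟩
      by_cases hzu : z = u
      · exact ⟨.inl none, hzu.symm⟩
      by_cases hzp : z = p
      · exact ⟨.inl (some 0), hzp.symm⟩
      · exact ⟨.inr (some (e.symm ⟨z, hzv, hzu, hzp⟩)), by simp [g]⟩
  refine ⟨RelIso.symm ⟨Equiv.ofBijective g hg, ?_⟩⟩
  rintro ((_ | i) | (_ | i)) ((_ | j) | (_ | j)) <;>
    simp [g, doubleStar, hv, hp, hu, hl _ (he1 _) (he2 _) (he3 _), he1, he2, he3, h1, h2, h3,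
      h1.symm, h3.symm]
  all_goals exact Fin.fin_one_eq_zero _

theorem nonempty_iso_doubleStar_iff [Fintype V] {G : SimpleGraph V} :
    Nonempty (G ≃g doubleStar 2 (Fintype.card V - 2)) ↔ ∃ v u p, G.IsBroom v u p := by
  constructor
  · rintro ⟨e⟩
    exact ⟨_, _, _, (isBroom_doubleStar _).map e.symm⟩
  · rintro ⟨v, u, p, h⟩
    exact h.nonempty_iso

/-- All edges at the centre `v` need different colours. Of two neighbours of `v` at least one is a
leaf, and the only path between them passes through `v`, so its two edges are consecutive. -/
theorem IsBroom.le_properConnectionNumber [Fintype V] {G : SimpleGraph V} {v u p : V}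
    (h : G.IsBroom v u p) (hG : G.Connected) :
    Fintype.card V - 2 ≤ G.properConnectionNumber := by
  classical
  obtain ⟨c, hc⟩ := exists_coloring_properConnectionNumber hG
  have key : ∀ x y (hx : G.Adj v x) (hy : G.Adj v y), x ≠ y → x ≠ u →
      c.get v x hx ≠ c.get v y hy := by
    intro x y hx hy hxy hxu
    have hleaf : ∀ z, G.Adj v z → z ≠ u → ∀ w, G.Adj z w → w = v := by
      intro z hz hzu w hw
      have := (h.adj_center z).1 hz
      exact (h.adj_leaf z this.1 hzu this.2 w).1 hw
    obtain ⟨q, hq, hch⟩ := hc x y hxy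
    cases q with
    | nil => exact (hxy rfl).elim
    | @cons _ w _ h1 q =>
      obtain rfl := hleaf x hx hxu w h1
      cases q with
      | nil => exact (hy.ne rfl).elim
      | @cons _ z _ h2 q =>
        have hwq : w ∉ q.support := by
          have := ((Walk.cons_isPath_iff _ _).1 ((Walk.cons_isPath_iff _ _).1 hq).1).2
          exact this
        -- If the path went on after `z`, then `z` or `y` would be a leaf at the centre, and the
        -- path would visit the centre a second time.
        have hzy : z = y := by
          by_contra hzy
          have hnil : ¬ q.Nil := Walk.not_nil_of_ne hzy
          by_cases hyu : y = u
          · have := hleaf z h2 (hyu ▸ hzy) _ (q.adj_snd hnil)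
            exact hwq (this ▸ q.getVert_mem_support _)
          · have := hleaf y hy hyu _ (q.adj_penultimate hnil).symm
            exact hwq (this ▸ q.getVert_mem_support _)
        subst hzy
        simp only [Walk.darts_cons, List.map_cons, List.isChain_cons_cons] at hch
        have := hch.1
        rwa [c.get_comm] at this
  let φ : {z // z ≠ v ∧ z ≠ p} → Fin G.properConnectionNumber :=
    fun z => c.get v z.1 ((h.adj_center z.1).2 z.2)
  have hφ : Function.Injective φ := by
    rintro ⟨x, hx⟩ ⟨y, hy⟩ hxy
    by_contra hne
    have hne' : x ≠ y := fun h => hne (Subtype.ext h)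
    by_cases hxu : x = u
    · exact key y x _ _ hne'.symm (fun h => hne' (hxu.trans h.symm)) hxy.symm
    · exact key x y _ _ hne' hxu hxy
  have h1 := Fintype.card_le_of_injective φ hφ
  rw [Fintype.card_fin, Fintype.card_subtype] at h1
  have h2 : (Finset.univ.filter fun z : V => z ≠ v ∧ z ≠ p) = ({v, p} : Finset V)ᶜ := by
    ext z
    simp
  rwa [h2, Finset.card_compl, Finset.card_pair h.ne_vp] at h1

theorem exists_neighborSet_subset_compl_pair [Fintype V] {G : SimpleGraph V} (hGc : Gᶜ.Connected)
    (hn : 2 ≤ Fintype.card V) (v : V) :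
    ∃ p, p ≠ v ∧ ¬ G.Adj v p ∧ G.neighborSet v ⊆ {v, p}ᶜ := by
  have : Nontrivial V := Fintype.one_lt_card_iff_nontrivial.1 hn
  obtain ⟨y, hy⟩ := exists_ne v
  obtain ⟨a, ha, b, -, hab⟩ := hGc.exists_adj_mem_not_mem (S := {v}) (x := v) (y := y) rfl hy
  obtain rfl : a = v := ha
  rw [compl_adj] at hab
  refine ⟨b, hab.1.symm, hab.2, fun z hz => ?_⟩
  rintro (rfl | rfl)
  · exact hz.ne rfl
  · exact hab.2 hz

theorem ncard_compl_pair [Fintype V] {x y : V} (h : x ≠ y) :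
    ({x, y}ᶜ : Set V).ncard = Fintype.card V - 2 := by
  rw [Set.ncard_compl, Nat.card_eq_fintype_card, Set.ncard_pair h]

theorem IsBroom.properConnectionNumber_eq [Fintype V] {G : SimpleGraph V} {v u p : V}
    (h : G.IsBroom v u p) (hn : 3 ≤ Fintype.card V) (hG : G.Connected) (hGc : Gᶜ.Connected) :
    G.properConnectionNumber = Fintype.card V - 2 := by
  refine le_antisymm ?_ (h.le_properConnectionNumber hG)
  refine properConnectionNumber_le_of_degree_le le_rfl hG (by omega) fun x => ?_
  obtain ⟨y, hyx, -, hsub⟩ := exists_neighborSet_subset_compl_pair hGc (by omega) x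
  rw [← ncard_compl_pair hyx.symm]
  exact Set.ncard_le_ncard hsub

/-- A vertex `v` adjacent to all vertices but `p`, a path from `v` to `p` through `u`, and one more
edge `b b'`: then the edge `v b` can be dropped from the spanning double star. -/
theorem properConnectionNumber_le_of_extra_edge [Fintype V] {G : SimpleGraph V}
    (hn : 5 ≤ Fintype.card V) {v u p b b' : V} (hvp : v ≠ p)
    (hv : ∀ z, z ≠ v → z ≠ p → G.Adj v z) (hup : G.Adj u p) (huv : u ≠ v) (hbv : b ≠ v)
    (hbp : b ≠ p) (hb'v : b' ≠ v) (hb'u : b' ≠ u) (hbb' : G.Adj b b') (hne : b = u → b' ≠ p) :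
    G.properConnectionNumber ≤ Fintype.card V - 3 := by
  classical
  -- The edge `bb'` replaces `vb` in the spanning double star, so `v` has degree at most n - 3.
  -- Every other vertex has degree at most 2, which is at most n - 3; for `u` this needs `b' ≠ u`.
  let F : SimpleGraph V := fromRel fun x y =>
    (x = v ∧ y ≠ v ∧ y ≠ p ∧ y ≠ b) ∨ (x = u ∧ y = p) ∨ (x = b ∧ y = b')
  have hup' := hup.ne
  have hbb'' := hbb'.ne
  have hFv : ∀ z, z ≠ v → z ≠ p → z ≠ b → F.Adj z v := by
    intro z h1 h2 h3
    simp [F, h1, h2, h3]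
  have hFpu : F.Adj p u := by
    simp [F, hup'.symm]
  have hFbb' : F.Adj b b' := by
    simp [F, hbb'']
  have hFG : F ≤ G := by
    intro x y hxy
    simp only [F, fromRel_adj] at hxy
    obtain ⟨-, (⟨rfl, h1, h2, -⟩ | ⟨rfl, rfl⟩ | ⟨rfl, rfl⟩) |
      (⟨rfl, h1, h2, -⟩ | ⟨rfl, rfl⟩ | ⟨rfl, rfl⟩)⟩ := hxy
    exacts [hv _ h1 h2, hup, hbb', (hv _ h1 h2).symm, hup.symm, hbb'.symm]
  have hreach : ∀ z, F.Reachable z v := by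
    have h1 : ∀ z, z ≠ p → z ≠ b → F.Reachable z v := by
      intro z hzp hzb
      by_cases hzv : z = v
      · rw [hzv]
      · exact (hFv z hzv hzp hzb).reachable
    have h2 : F.Reachable b v ∧ F.Reachable p v := by
      by_cases hbu : b = u
      · have hb : F.Reachable b v :=
          hFbb'.reachable.trans (h1 b' (hne hbu) hbb''.symm)
        exact ⟨hb, hFpu.reachable.trans (hbu ▸ hb)⟩
      · have hp : F.Reachable p v := hFpu.reachable.trans (h1 u hup' (Ne.symm hbu))
        refine ⟨hFbb'.reachable.trans ?_, hp⟩
        by_cases hb'p : b' = p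
        · exact hb'p ▸ hp
        · exact h1 b' hb'p hbb''.symm
    intro z
    by_cases hzp : z = p
    · exact hzp ▸ h2.2
    by_cases hzb : z = b
    · exact hzb ▸ h2.1
    · exact h1 z hzp hzb
  have hF : F.Connected :=
    { preconnected := fun x y => (hreach x).trans (hreach y).symm
      nonempty := ⟨v⟩ }
  refine properConnectionNumber_le_of_degree_le hFG hF (by omega) fun z => ?_
  have htwo : ∀ s t : V, (∀ y, F.Adj z y → y = s ∨ y = t) →
      (F.neighborSet z).ncard ≤ Fintype.card V - 3 := by
    intro s t hst
    have h1 : (F.neighborSet z).ncard ≤ ({s, t} : Set V).ncard := Set.ncard_le_ncard hst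
    have h2 := Set.ncard_insert_le s {t}
    rw [Set.ncard_singleton] at h2
    omega
  simp only [F, fromRel_adj] at htwo
  by_cases hzv : z = v
  · have hsub : F.neighborSet z ⊆ {v, p, b}ᶜ := by
      intro y hy
      simp only [F, mem_neighborSet, fromRel_adj] at hy
      simp only [Set.mem_compl_iff, Set.mem_insert_iff, Set.mem_singleton_iff]
      grind
    have h1 := Set.ncard_le_ncard hsub
    have h3 : ({v, p, b} : Set V).ncard = 3 :=
      Set.ncard_eq_three.2 ⟨v, p, b, hvp, hbv.symm, hbp.symm, rfl⟩
    rwa [Set.ncard_compl, Nat.card_eq_fintype_card, h3] at h1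
  by_cases hzp : z = p
  · exact htwo u b (by grind)
  by_cases hzu : z = u
  · exact htwo p (if b = u then b' else v) (by grind)
  · exact htwo (if z = b then b' else v) b (by grind)

/-- A vertex of degree above n - 3 misses exactly one other vertex, as the complement is connected.
Its star and an edge to the missed vertex form a spanning double star, so `G` is that double star or
has an extra edge. -/
theorem exists_isBroom_or_properConnectionNumber_le [Fintype V] {G : SimpleGraph V}
    (hn : 5 ≤ Fintype.card V) (hG : G.Connected) (hGc : Gᶜ.Connected) :
    (∃ v u p, G.IsBroom v u p) ∨ G.properConnectionNumber ≤ Fintype.card V - 3 := by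
  by_cases hdeg : ∀ v, (G.neighborSet v).ncard ≤ Fintype.card V - 3
  · exact .inr (properConnectionNumber_le_of_degree_le le_rfl hG (by omega) hdeg)
  push Not at hdeg
  obtain ⟨v, hdv⟩ := hdeg
  obtain ⟨p, hpv, hadj, hsub⟩ := exists_neighborSet_subset_compl_pair hGc (by omega) v
  have hN : G.neighborSet v = {v, p}ᶜ := by
    refine Set.eq_of_subset_of_ncard_le hsub ?_
    rw [ncard_compl_pair hpv.symm]
    omega
  have hv : ∀ z, G.Adj v z ↔ z ≠ v ∧ z ≠ p := by
    intro z
    rw [← mem_neighborSet, hN]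
    simp
  obtain ⟨a, ha, u, -, hpu⟩ := hG.exists_adj_mem_not_mem (S := {p}) (x := p) (y := v) rfl hpv.symm
  obtain rfl : a = p := ha
  have huv : u ≠ v := by
    rintro rfl
    exact hadj hpu.symm
  by_cases h1 : ∀ y, G.Adj a y → y = u
  · by_cases h2 : ∀ z, z ≠ v → z ≠ u → z ≠ a → ∀ y, G.Adj z y → y = v
    · refine .inl ⟨v, u, a, huv.symm, hpu.ne.symm, hpv.symm, hv, ?_, ?_⟩
      · intro z hzv hzu hza y
        exact ⟨h2 z hzv hzu hza y, fun h => h ▸ ((hv z).2 ⟨hzv, hza⟩).symm⟩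
      · exact fun y => ⟨h1 y, fun h => h ▸ hpu⟩
    · push Not at h2
      obtain ⟨z, hzv, hzu, hza, y, hzy, hyv⟩ := h2
      right
      refine properConnectionNumber_le_of_extra_edge hn (b := y) (b' := z) hpv.symm
        (fun z h1 h2 => (hv z).2 ⟨h1, h2⟩) hpu.symm huv hyv ?_ hzv hzu hzy.symm fun _ => hza
      rintro rfl
      exact hzu (h1 z hzy.symm)
  · push Not at h1
    obtain ⟨y, hay, hyu⟩ := h1
    right
    refine properConnectionNumber_le_of_extra_edge hn (b := y) (b' := a) hpv.symm
      (fun z h1 h2 => (hv z).2 ⟨h1, h2⟩) hpu.symm huv ?_ hay.ne.symm hpv hpu.ne hay.symm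
      fun h => (hyu h).elim
    rintro rfl
    exact hadj hay.symm

/-! ### The lower bound and the theorem -/

theorem two_le_properConnectionNumber_of_compl [Fintype V] {G : SimpleGraph V}
    (hn : 2 ≤ Fintype.card V) (hG : G.Connected) (hGc : Gᶜ.Connected) :
    2 ≤ G.properConnectionNumber := by
  obtain ⟨v⟩ := hG.nonempty
  obtain ⟨p, hpv, hadj, -⟩ := exists_neighborSet_subset_compl_pair hGc hn v
  exact two_le_properConnectionNumber hG hpv.symm hadj

end SimpleGraph

theorem mainTheorem1 {V : Type*} [Fintype V] (G : SimpleGraph V) (n : ℕ)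
    (hcard : Fintype.card V = n) (hn : 5 ≤ n) (hG : G.Connected) (hGc : Gᶜ.Connected) :
    4 ≤ G.properConnectionNumber + Gᶜ.properConnectionNumber ∧
    G.properConnectionNumber + Gᶜ.properConnectionNumber ≤ n ∧
    (G.properConnectionNumber + Gᶜ.properConnectionNumber = n ↔
      Nonempty (G ≃g SimpleGraph.doubleStar 2 (n - 2)) ∨
      Nonempty (Gᶜ ≃g SimpleGraph.doubleStar 2 (n - 2))) := by
  subst hcard
  have hGcc : Gᶜᶜ.Connected := by rwa [compl_compl]
  rw [SimpleGraph.nonempty_iso_doubleStar_iff, SimpleGraph.nonempty_iso_doubleStar_iff]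
  have h1 := SimpleGraph.two_le_properConnectionNumber_of_compl (by omega) hG hGc
  have h2 := SimpleGraph.two_le_properConnectionNumber_of_compl (by omega) hGc hGcc
  have h3 : G.properConnectionNumber ≤ 2 ∨ Gᶜ.properConnectionNumber ≤ 2 :=
    (G.hasAltColoring_or_compl_hasAltColoring hn hG hGc).imp
      SimpleGraph.HasAltColoring.properConnectionNumber_le
      SimpleGraph.HasAltColoring.properConnectionNumber_le
  have h4 := SimpleGraph.exists_isBroom_or_properConnectionNumber_le hn hG hGc
  have h5 := SimpleGraph.exists_isBroom_or_properConnectionNumber_le hn hGc hGcc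
  have h6 : (∃ v u p, G.IsBroom v u p) → G.properConnectionNumber = Fintype.card V - 2 := by
    rintro ⟨v, u, p, h⟩
    exact h.properConnectionNumber_eq (by omega) hG hGc
  have h7 : (∃ v u p, Gᶜ.IsBroom v u p) → Gᶜ.properConnectionNumber = Fintype.card V - 2 := by
    rintro ⟨v, u, p, h⟩
    exact h.properConnectionNumber_eq (by omega) hGc hGcc
  -- Both graphs cannot be double stars, since one value is at most 2 < n - 2. If exactly one is,
  -- the other value is 2 and the sum is n; if none is, the sum is at most 2 + (n - 3).
  by_cases hA : ∃ v u p, G.IsBroom v u p <;> by_cases hB : ∃ v u p, Gᶜ.IsBroom v u p <;>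
    simp only [hA, hB, true_imp_iff, false_or, or_false, or_true, iff_true, iff_false] at * <;>
    omega
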